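/- **Setting.** Let $V$ be a finite set of at least two users and $T=(V,E)$ a tree. For every edge $e$ let $n_e\ge 0$ be an integer and $Y_e=(X_{e,1},\dots,X_{e,n_e})$, where the entries of the base vector $X=(X_{e,k})_{e\in E,\,1\le k\le n_e}$ are i.i.d. uniform on a finite field $\mathbb F_q$. User $i\in V$ observes $Z_i=(Y_e: i\in e)$, and $Z_V=(Z_i)_{i\in V}$. The wiretapper observes $Z_{\mathrm w}=XW$, where $W$ is a $\big(\sum_e n_e\big)\times n_w$ matrix over $\mathbb F_q$ of full column rank. This is a *tree-PIN source with linear wiretapper*. A maximal common function $\mathrm{mcf}(A,B)$ of two random variables is a random variable $G$ with $H(G|A)=H(G|B)=0$ of the largest entropy; the source is *irreducible* if $\mathrm{mcf}(Y_e,Z_{\mathrm w})$ is constant for every $e\in E$. On $n$ i.i.d. realizations of the source the users, who also have independent private randomness, communicate interactively in public. The communication, of finitely many rounds and with finite alphabets, is $F^{(n)}$; every message depends on the earlier messages and on the observations and private randomness of its sender. User $i$ then outputs $E_i^{(n)}$, a function of $F^{(n)}$, $Z_i^n$ and the private randomness of user $i$. All logarithms and entropies are to base $2$. * An *omniscience scheme*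 satisfies $\lim_n\Pr(E_i^{(n)}=Z_V^n\ \forall i\in V)=1$, and $R_L=\inf\ \limsup_n\frac1n I(F^{(n)}\wedge Z_V^n\mid Z_{\mathrm w}^n)$ over all omniscience schemes. * A *secret key agreement scheme* has random variables $K^{(n)}$ with values in finite sets $\mathcal K^{(n)}$ such that $\lim_n\Pr(E_i^{(n)}=K^{(n)}\ \forall i\in V)=1$ and $\lim_n\big[\log_2|\mathcal K^{(n)}|-H(K^{(n)}\mid F^{(n)},Z_{\mathrm w}^n)\big]=0$; $C_W=\sup\ \liminf_n\frac1n\log_2|\mathcal K^{(n)}|$ over all such schemes, and $C_S$ is the value of $C_W$ when $Z_{\mathrm w}$ is replaced by a constant. **Theorem.** If the tree-PIN source with linear wiretapper is irreducible, then $$C_W=\min_{e\in E}H(Y_e)=C_S,\qquad R_L=\Big(\sum_{e\in E}n_e-n_w\Big)\log_2 q-C_S .$$ -/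

import Mathlib

open MeasureTheory Filter Topology

universe u v a b c

noncomputable section

/-! Entropies (in bits) of finite-valued random variables on a probability space. -/

/-- Shannon entropy `H(X)` in bits. -/
def entropy {Ω : Type*} [MeasurableSpace Ω] (μ : Measure Ω) {A : Type*} [Finite A]
    (X : Ω → A) : ℝ :=
  ∑' x : A, Real.negMulLog (μ.real (X ⁻¹' {x})) / Real.log 2

/-- Conditional entropy `H(X | Y) = H(X, Y) - H(Y)` in bits. -/
def condEntropy {Ω : Type*} [MeasurableSpace Ω] (μ : Measure Ω) {A B : Type*} [Finite A] [Finite B]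
    (X : Ω → A) (Y : Ω → B) : ℝ :=
  entropy μ (fun ω => (X ω, Y ω)) - entropy μ Y

/-- Conditional mutual information `I(X ∧ Y | Z) = H(X | Z) - H(X | Y, Z)` in bits. -/
def condMutualInfo {Ω : Type*} [MeasurableSpace Ω] (μ : Measure Ω) {A B C : Type*}
    [Finite A] [Finite B] [Finite C] (X : Ω → A) (Y : Ω → B) (Z : Ω → C) : ℝ :=
  condEntropy μ X Z - condEntropy μ X (fun ω => (Y ω, Z ω))

/-- `G` is a common function of `X` and `Y`: `H(G | X) = H(G | Y) = 0`. -/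
def IsCommonFunction {Ω : Type*} [MeasurableSpace Ω] (μ : Measure Ω) {A B G : Type*}
    [Finite A] [Finite B] [Finite G] (X : Ω → A) (Y : Ω → B) (g : Ω → G) : Prop :=
  condEntropy μ g X = 0 ∧ condEntropy μ g Y = 0

/-- `g` is a maximal common function of `X` and `Y`: a common function of largest entropy. -/
def IsMaximalCommonFunction {Ω : Type*} [MeasurableSpace Ω] (μ : Measure Ω) {A B G : Type*}
    [Finite A] [Finite B] [Finite G] (X : Ω → A) (Y : Ω → B) (g : Ω → G) : Prop :=
  IsCommonFunction μ X Y g ∧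
    ∀ (G' : Type) [Finite G'] (g' : Ω → G'), IsCommonFunction μ X Y g' → entropy μ g' ≤ entropy μ g

/-- A multiterminal source with a wiretapper: finite-valued random variables `Z_i` (`i ∈ V`), the
users' observations, and `Z_w`, the wiretapper's, on a finite probability space `Ω`. -/
structure Source (V : Type u) where
  Ω : Type a
  finΩ : Finite Ω
  law : PMF Ω
  Z : V → Type b
  finZ : ∀ i, Finite (Z i)
  obs : ∀ i, Ω → Z i
  W : Type c
  finW : Finite W
  wiretap : Ω → W

attribute [instance] Source.finΩ Source.finZ Source.finW

namespace Source

variable {V : Type u}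

instance (S : Source.{u, a, b, c} V) : MeasurableSpace S.Ω := ⊤

/-- The probability measure of the sample space. -/
def measure (S : Source.{u, a, b, c} V) : Measure S.Ω := S.law.toMeasure

instance (S : Source.{u, a, b, c} V) : IsProbabilityMeasure S.measure := by
  unfold measure; infer_instance

/-- The same users' source with a constant wiretapper observation. -/
def withoutWiretapper (S : Source.{u, a, b, c} V) : Source.{u, a, b, c} V where
  Ω := S.Ω
  finΩ := S.finΩ
  law := S.law
  Z := S.Z
  finZ := S.finZ
  obs := S.obs
  W := PUnit
  finW := inferInstance
  wiretap := fun _ => PUnit.unit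

/-- An interactive public discussion on `n` i.i.d. realizations of the source. User `i` has private
randomness, distributed on an arbitrary probability space `R i` by `P i`. Messages are
sent one after the other; the message number `t` is sent by `speaker t` and depends on the
earlier messages and on the observations and the private randomness of its speaker. The discussion
consists of the messages number `0, …, len - 1`. All messages are encoded in one finite alphabet. -/
structure Discussion (S : Source.{u, a, b, c} V) (n : ℕ) where
  R : V → Type
  measR : ∀ i, MeasurableSpace (R i)
  P : ∀ i, Measure (R i)
  probP : ∀ i, IsProbabilityMeasure (P i)
  A : Type
  finA : Finite A
  len : ℕ
  speaker : ℕ → V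
  msg : ∀ t : ℕ, (Fin t → A) → (Fin n → S.Z (speaker t)) → R (speaker t) → A
  measurable_msg : ∀ t h z x, MeasurableSet {r | msg t h z r = x}

attribute [instance] Discussion.measR Discussion.probP Discussion.finA

namespace Discussion

variable {S : Source.{u, a, b, c} V} {n : ℕ}

/-- Sample space: `n` realizations of the source and everybody's private randomness. -/
abbrev Sample (D : S.Discussion n) : Type _ := (Fin n → S.Ω) × (∀ i, D.R i)

/-- The realizations of the source are i.i.d., the private random variables are mutually
independent and independent of the source. -/
def measure [Fintype V] (D : S.Discussion n) : Measure D.Sample :=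
  (Measure.pi fun _ : Fin n => S.measure).prod (Measure.pi D.P)

/-- `Z_i^n`, the observations of user `i`. -/
def obsN (D : S.Discussion n) (i : V) (ω : D.Sample) : Fin n → S.Z i :=
  fun t => S.obs i (ω.1 t)

/-- `Z_V^n`, the observations of all the users. -/
def obsAll (D : S.Discussion n) (ω : D.Sample) : ∀ i, Fin n → S.Z i :=
  fun i => D.obsN i ω

/-- `Z_w^n`, the observations of the wiretapper. -/
def wiretapN (D : S.Discussion n) (ω : D.Sample) : Fin n → S.W :=
  fun t => S.wiretap (ω.1 t)

/-- The first `t` messages. -/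
def history (D : S.Discussion n) : (t : ℕ) → D.Sample → (Fin t → D.A)
  | 0, _ => Fin.elim0
  | t + 1, ω =>
      Fin.snoc (D.history t ω)
        (D.msg t (D.history t ω) (D.obsN (D.speaker t) ω) (ω.2 (D.speaker t)))

/-- `F^(n)`, the whole public communication. -/
def comm (D : S.Discussion n) (ω : D.Sample) : Fin D.len → D.A := D.history D.len ω

/-- Outputs of the users with values in `B`: user `i` uses the public communication, the user's own
observations and the user's own private randomness. -/
structure Outputs (D : S.Discussion n) (B : Type*) where
  out : ∀ i, (Fin D.len → D.A) → (Fin n → S.Z i) → D.R i → B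
  measurable_out : ∀ i f z x, MeasurableSet {r | out i f z r = x}

/-- The random variable `E_i^(n)`, the output of user `i`. -/
def Outputs.E {D : S.Discussion n} {B : Type*} (o : D.Outputs B) (i : V) (ω : D.Sample) : B :=
  o.out i (D.comm ω) (D.obsN i ω) (ω.2 i)

end Discussion

variable [Fintype V]

/-- Omniscience schemes: `Pr(E_1^(n) = ⋯ = E_m^(n) = Z_V^n) → 1`. (A sequence of probabilities has
limit inferior `1` iff it tends to `1`.) -/
structure OmniscienceScheme (S : Source.{u, a, b, c} V) where
  D : ∀ n, S.Discussion n
  o : ∀ n, (D n).Outputs (∀ i, Fin n → S.Z i)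
  recoverable :
    Tendsto (fun n => (D n).measure.real {ω | ∀ i, (o n).E i ω = (D n).obsAll ω}) atTop (𝓝 1)

/-- The minimum leakage rate for omniscience `R_L`, the infimum over all omniscience schemes of
`limsup (1/n) I(F^(n) ∧ Z_V^n | Z_w^n)`. -/
def RL (S : Source.{u, a, b, c} V) : EReal :=
  ⨅ Q : S.OmniscienceScheme,
    limsup (fun n : ℕ =>
      ((1 / (n : ℝ) * condMutualInfo (Q.D n).measure (Q.D n).comm (Q.D n).obsAll (Q.D n).wiretapN
        : ℝ) : EReal)) atTop

/-- Secret key agreement schemes: key recoverability `Pr(E_1^(n) = ⋯ = E_m^(n) = K^(n)) → 1`, and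
secrecy `log |𝒦^(n)| - H(K^(n) | F^(n), Z_w^n) → 0`. (Probabilities are at most `1` and
the latter quantity is nonnegative, so these limits say the same as `liminf = 1` and
`limsup = 0`.) -/
structure SKAScheme (S : Source.{u, a, b, c} V) where
  D : ∀ n, S.Discussion n
  𝒦 : ℕ → Type
  fin𝒦 : ∀ n, Finite (𝒦 n)
  o : ∀ n, (D n).Outputs (𝒦 n)
  K : ∀ n, (D n).Sample → 𝒦 n
  measurable_K : ∀ n k, MeasurableSet {ω | K n ω = k}
  recoverable :
    Tendsto (fun n => (D n).measure.real {ω | ∀ i, (o n).E i ω = K n ω}) atTop (𝓝 1)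
  secret :
    Tendsto (fun n => Real.logb 2 (Nat.card (𝒦 n)) -
      condEntropy (D n).measure (K n) (fun ω => ((D n).comm ω, (D n).wiretapN ω))) atTop (𝓝 0)

/-- The wiretap secret key capacity `C_W`, the supremum over all secret key agreement schemes of
`liminf (1/n) log |𝒦^(n)|`. -/
def CW (S : Source.{u, a, b, c} V) : EReal :=
  ⨆ Q : S.SKAScheme,
    liminf (fun n : ℕ => ((1 / (n : ℝ) * Real.logb 2 (Nat.card (Q.𝒦 n)) : ℝ) : EReal)) atTop

/-- The secret key capacity `C_S`: no wiretapper side information. -/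
def CS (S : Source.{u, a, b, c} V) : EReal := S.withoutWiretapper.CW

end Source

/-- Data of a tree-PIN source with linear wiretapper over the field `F`: a tree `T` on `V`,
a nonnegative integer `n e` for every edge, and a matrix `W` of full column rank. -/
structure TreePIN (V : Type u) [Fintype V] (F : Type v) [Field F] where
  T : SimpleGraph V
  isTree : T.IsTree
  n : T.edgeSet → ℕ
  nw : ℕ
  W : Matrix ((e : T.edgeSet) × Fin (n e)) (Fin nw) F
  fullColumnRank : W.rank = nw

namespace TreePIN

variable {V : Type u} [Fintype V] {F : Type v} [Field F]

instance (S : TreePIN V F) : Fintype S.T.edgeSet := Fintype.ofFinite _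

/-- Values of the base vector `X = (X_{e,k})`. -/
abbrev Base (S : TreePIN V F) : Type (max u v) := ((e : S.T.edgeSet) × Fin (S.n e)) → F

/-- `Y_e = (X_{e,1}, …, X_{e,n_e})`. -/
def Y (S : TreePIN V F) (e : S.T.edgeSet) (x : S.Base) : Fin (S.n e) → F := fun k => x ⟨e, k⟩

/-- The base vector `X` is uniform (that is, its entries are i.i.d. uniform on `F`). -/
def baseLaw [Finite F] (S : TreePIN V F) : PMF S.Base :=
  letI : Fintype S.Base := Fintype.ofFinite _
  PMF.uniformOfFintype S.Base

/-- The source: the base vector `X` is distributed by `baseLaw`,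
`Z_i = (Y_e : i ∈ e)`, and `Z_w = X W`. -/
def source [Fintype F] (S : TreePIN V F) : Source.{u, max u v, max u v, v} V where
  Ω := S.Base
  finΩ := inferInstance
  law := S.baseLaw
  Z := fun i => (e : {e : S.T.edgeSet // i ∈ (e : Sym2 V)}) → Fin (S.n e) → F
  finZ := fun _ => inferInstance
  obs := fun _ x e => S.Y e x
  W := Fin S.nw → F
  finW := inferInstance
  wiretap := fun x => Matrix.vecMul x S.W

/-- `H(Y_e)` in bits. -/
def edgeEntropy [Fintype F] (S : TreePIN V F) (e : S.T.edgeSet) : ℝ :=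
  entropy S.source.measure (A := Fin (S.n e) → F) (S.Y e)

/-- For every edge, `mcf(Y_e, Z_w)` is a constant function (almost surely). -/
def Irreducible [Fintype F] (S : TreePIN V F) : Prop :=
  ∀ e : S.T.edgeSet, ∃ (G : Type) (_ : Finite G) (g : S.source.Ω → G),
    IsMaximalCommonFunction S.source.measure (A := Fin (S.n e) → F) (S.Y e) S.source.wiretap g ∧
      ∃ x : G, ∀ᵐ ω ∂S.source.measure, g ω = x

end TreePIN

end

/-!
Let `s` be the least number of symbols of an edge, `q` the order of `F` and `N = ∑ n_e`. Everything
follows from one linear discussion and from one bound at a single edge.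

**Achievability.** Irreducibility says that no nonzero linear functional of `Y_e` is a functional of
`Z_w`, so that `x ↦ (x W, Y_e)` is onto for every edge (`TreePIN.Irreducible.surjective`): the left
kernel of `W` projects onto the coordinates of every edge. Regard `n` realizations as one
vector `X` over the extension `Q` of `F` of degree `n`. As soon as `Q` has more elements than the
tree has edges, a greedy choice gives `s` vectors `v_j` over `Q` in the left kernel of `W` whose
blocks at every edge are linearly independent (`TreePIN.Irreducible.exists_vectors`). User `i`
announces the block of `X` at `i` modulo the span of the blocks of the `v_j`. Since the tree is
connected and the coefficients can be read off at any edge, all announcements together amount to the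
coset of `X` modulo `U = span v_j` (`TreePIN.exists_eq_sum_of_forall_vertex`). Hence the
announcements determine `Z_w`, every user becomes omniscient, and the position of `X` in its coset is a
perfectly secret key of `n s log q` bits (`TreePIN.Irreducible.le_CW`). The leakage is
`H(F | Z_w) = n (N - s - n_w) log q` (`TreePIN.Irreducible.RL_le`).

**Converse.** Removing an edge `e` splits the users into two sides whose only common observation is
`Y_e`. Transcript events are rectangles, so given `F` and `Y_e ^ n` the outputs of the two sides are
independent (`Source.Cut.exists_factorization`); as they agree with high probability, each is close
to a function of `(F, Y_e ^ n)`, namely its most likely value (`Source.Cut.exists_guess`). By Fano's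
inequality in the form `condEntropy_le_of_list`, anything that all users can output has conditional
entropy at most `n n_e log q + o(n)` given `(F, Z_w)` (`TreePIN.condEntropy_le`). For a secret key
this bounds its rate, whatever the wiretapper sees; for `Z_V ^ n` it bounds the leakage
`H(Z_V | Z_w) - H(Z_V | F, Z_w)` from below.
-/

noncomputable section

/-! ### Generic vectors over a large finite field -/

theorem Submodule.card_mul_card_le_of_ne_top {Q M : Type*} [Field Q] [Finite Q] [AddCommGroup M]
    [Module Q M] [Finite M] {p : Submodule Q M} (hp : p ≠ ⊤) :
    Nat.card Q * Nat.card p ≤ Nat.card M := by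
  have : Nontrivial (M ⧸ p) := Submodule.Quotient.nontrivial_iff.2 hp
  rw [p.card_eq_card_quotient_mul_card, mul_comm]
  refine Nat.mul_le_mul_left _ ?_
  have : Finite (M ⧸ p) := Finite.of_surjective _ p.mkQ_surjective
  obtain ⟨m, hm⟩ := exists_ne (0 : M ⧸ p)
  exact Nat.card_le_card_of_injective (fun c : Q => c • m) (smul_left_injective Q hm)

/-- A vector space over a field with more than `#ι` elements is not covered by proper subspaces
indexed by `ι`. -/
theorem Submodule.exists_forall_notMem_of_card_lt {Q M ι : Type*} [Field Q] [Finite Q]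
    [AddCommGroup M] [Module Q M] [Finite M] [Fintype ι] (hι : Fintype.card ι < Nat.card Q)
    (p : ι → Submodule Q M) (hp : ∀ i, p i ≠ ⊤) : ∃ x, ∀ i, x ∉ p i := by
  classical
  by_contra! h
  have : Fintype M := Fintype.ofFinite M
  have hcov : (Finset.univ : Finset M) ⊆
      Finset.univ.biUnion fun i => Finset.univ.filter (· ∈ p i) := by
    intro x _
    obtain ⟨i, hi⟩ := h x
    simp only [Finset.mem_biUnion, Finset.mem_filter, Finset.mem_univ, true_and]
    exact ⟨i, hi⟩
  have h1 := (Finset.card_le_card hcov).trans Finset.card_biUnion_le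
  have h2 : ∀ i, Nat.card Q * (Finset.univ.filter (· ∈ p i)).card ≤ Nat.card M := fun i => by
    have := Submodule.card_mul_card_le_of_ne_top (hp i)
    rwa [Nat.card_eq_fintype_card (α := p i), Fintype.card_subtype] at this
  have h3 := Finset.sum_le_sum fun i (_ : i ∈ Finset.univ) => h2 i
  rw [← Finset.mul_sum] at h3
  simp only [Finset.sum_const, Finset.card_univ, smul_eq_mul] at h3 h1
  rw [← Nat.card_eq_fintype_card (α := M)] at h1
  have hM : 0 < Nat.card M := Nat.card_pos
  nlinarith [Nat.mul_le_mul_left (Nat.card Q) h1]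

/-- Vectors whose images under finitely many surjections are simultaneously linearly
independent, chosen one after the other outside the preimages of the spans of the earlier images. -/
theorem exists_forall_linearIndependent {Q M ι : Type*} [Field Q] [Finite Q]
    [AddCommGroup M] [Module Q M] [Finite M] [Fintype ι] (hι : Fintype.card ι < Nat.card Q)
    {N : ι → Type*} [∀ i, AddCommGroup (N i)] [∀ i, Module Q (N i)]
    (π : ∀ i, M →ₗ[Q] N i) (hπ : ∀ i, Function.Surjective (π i)) (s : ℕ)
    (hs : ∀ i, s ≤ Module.finrank Q (N i)) :
    ∃ v : Fin s → M, ∀ i, LinearIndependent Q fun j => π i (v j) := by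
  induction s with
  | zero => exact ⟨Fin.elim0, fun i => linearIndependent_empty_type⟩
  | succ s ih =>
    obtain ⟨v, hv⟩ := ih fun i => (Nat.le_succ s).trans (hs i)
    obtain ⟨x, hx⟩ := Submodule.exists_forall_notMem_of_card_lt hι
      (fun i => (Submodule.span Q (Set.range fun j => π i (v j))).comap (π i)) fun i h => by
        have hfin : Module.finrank Q (Submodule.span Q (Set.range fun j => π i (v j))) = s := by
          rw [finrank_span_eq_card (hv i), Fintype.card_fin]
        have : Submodule.span Q (Set.range fun j => π i (v j)) = ⊤ := by
          rw [eq_top_iff]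
          intro y _
          obtain ⟨x, rfl⟩ := hπ i y
          have : x ∈ (Submodule.span Q (Set.range fun j => π i (v j))).comap (π i) :=
            h ▸ Submodule.mem_top
          exact this
        rw [this, finrank_top] at hfin
        have := hs i
        omega
    refine ⟨Fin.snoc v x, fun i => ?_⟩
    have : (fun j => π i (Fin.snoc (α := fun _ => M) v x j)) =
        Fin.snoc (α := fun _ => N i) (fun j => π i (v j)) (π i x) := by
      ext j
      refine Fin.lastCases ?_ (fun j => ?_) j <;> simp
    rw [this, linearIndependent_finSnoc]
    exact ⟨hv i, hx i⟩

/-! ### Entropies of functions of a uniform random variable -/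

theorem condMutualInfo_eq {Ω : Type*} [MeasurableSpace Ω] (μ : Measure Ω) {A B C : Type*}
    [Finite A] [Finite B] [Finite C] (X : Ω → A) (Y : Ω → B) (Z : Ω → C) :
    condMutualInfo μ X Y Z = entropy μ (fun ω => (X ω, Z ω)) - entropy μ Z -
      (entropy μ (fun ω => (X ω, (Y ω, Z ω))) - entropy μ (fun ω => (Y ω, Z ω))) := rfl

/-- `H(f) = log |G| - log |U|` when `f` is, up to relabelling, the coset modulo `U` of a random
variable `θ` uniform on `G`. -/
theorem entropy_eq_of_uniform {Ω : Type*} [MeasurableSpace Ω] {μ : Measure Ω}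
    [IsProbabilityMeasure μ] {G B : Type*} [AddCommGroup G] [Finite G] [Finite B] {θ : Ω → G}
    (hθm : ∀ x, MeasurableSet (θ ⁻¹' {x}))
    (hθ : ∀ x, μ.real (θ ⁻¹' {x}) = (Nat.card G : ℝ)⁻¹) (U : AddSubgroup G) {f : Ω → B}
    (hf : ∀ ω ω', f ω = f ω' ↔ θ ω - θ ω' ∈ U) :
    entropy μ f = Real.logb 2 (Nat.card G) - Real.logb 2 (Nat.card U) := by
  classical
  have : Fintype G := Fintype.ofFinite G
  have : Fintype B := Fintype.ofFinite B
  have hsurj : Function.Surjective θ := fun x => by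
    by_contra! h
    have : θ ⁻¹' {x} = ∅ := by
      ext ω
      simpa using h ω
    have h2 := hθ x
    rw [this, measureReal_empty] at h2
    have : (0 : ℝ) < (Nat.card G : ℝ)⁻¹ := inv_pos.2 (Nat.cast_pos.2 Nat.card_pos)
    linarith
  have hU0 : (0 : ℝ) < Nat.card U := Nat.cast_pos.2 Nat.card_pos
  have hG0 : (0 : ℝ) < Nat.card G := Nat.cast_pos.2 Nat.card_pos
  have hfm : ∀ b, f ⁻¹' {b} = ⋃ x ∈ θ '' (f ⁻¹' {b}), θ ⁻¹' {x} := by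
    intro b
    ext ω
    simp only [Set.mem_preimage, Set.mem_singleton_iff, Set.mem_iUnion, Set.mem_image]
    constructor
    · exact fun h => ⟨θ ω, ⟨ω, h, rfl⟩, rfl⟩
    · rintro ⟨x, ⟨ω', h', rfl⟩, hx⟩
      rw [← h', hf, hx, sub_self]
      exact U.zero_mem
  have hmeas : ∀ b, MeasurableSet (f ⁻¹' {b}) := fun b => by
    rw [hfm]
    exact MeasurableSet.biUnion (Set.to_countable _) fun x _ => hθm x
  -- every nonempty fibre of `f` has probability `|U| / |G|`
  have hpr : ∀ ω₀, μ.real (f ⁻¹' {f ω₀}) = Nat.card U / Nat.card G := by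
    intro ω₀
    have himg : θ '' (f ⁻¹' {f ω₀}) = {x | x - θ ω₀ ∈ U} := by
      ext x
      constructor
      · rintro ⟨ω, h, rfl⟩
        exact (hf _ _).1 h
      · intro h
        obtain ⟨ω, rfl⟩ := hsurj x
        exact ⟨ω, (hf _ _).2 h, rfl⟩
    have hfin : f ⁻¹' {f ω₀} = ⋃ x ∈ Finset.univ.filter (fun x => x - θ ω₀ ∈ U), θ ⁻¹' {x} := by
      rw [hfm, himg]
      simp
    rw [hfin, measureReal_biUnion_finset]
    · simp only [hθ, Finset.sum_const, nsmul_eq_mul, div_eq_mul_inv]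
      congr 2
      rw [← Fintype.card_subtype, Nat.card_eq_fintype_card]
      exact Fintype.card_congr
        ((Equiv.subRight (θ ω₀)).subtypeEquiv fun x => by simp)
    · intro x _ y _ hxy
      exact Disjoint.preimage _ (Set.disjoint_singleton.2 hxy)
    · exact fun x _ => hθm x
  have hval : ∀ b, Real.negMulLog (μ.real (f ⁻¹' {b})) / Real.log 2 =
      μ.real (f ⁻¹' {b}) * (Real.logb 2 (Nat.card G) - Real.logb 2 (Nat.card U)) := by
    intro b
    by_cases hb : ∃ ω, f ω = b
    · obtain ⟨ω, rfl⟩ := hb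
      rw [hpr, Real.negMulLog, Real.log_div hU0.ne' hG0.ne', Real.logb, Real.logb]
      ring
    · have : f ⁻¹' {b} = ∅ := by
        ext ω
        simpa using fun h => hb ⟨ω, h⟩
      simp [this]
  rw [entropy, tsum_fintype]
  simp_rw [hval]
  rw [← Finset.sum_mul]
  have hone : ∑ b, μ.real (f ⁻¹' {b}) = 1 := by
    rw [← measureReal_biUnion_finset]
    · have : (⋃ b ∈ (Finset.univ : Finset B), f ⁻¹' {b}) = Set.univ := by ext; simp
      rw [this]
      simp
    · intro x _ y _ hxy
      exact Disjoint.preimage _ (Set.disjoint_singleton.2 hxy)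
    · exact fun x _ => hmeas x
  rw [hone, one_mul]

theorem entropy_eq_zero_of_ae_const {Ω : Type*} [MeasurableSpace Ω] {μ : Measure Ω}
    [IsProbabilityMeasure μ] {B : Type*} [Finite B] {f : Ω → B} {x : B}
    (h : ∀ᵐ ω ∂μ, f ω = x) : entropy μ f = 0 := by
  rw [entropy]
  convert! tsum_zero with b
  by_cases hb : b = x
  · have : μ.real (f ⁻¹' {b}) = μ.real Set.univ := by
      refine measureReal_congr ?_
      filter_upwards [h] with ω hω
      exact propext ⟨fun _ => trivial, fun _ => hω.trans hb.symm⟩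
    rw [this]
    simp
  · have : μ.real (f ⁻¹' {b}) = μ.real ∅ := by
      refine measureReal_congr ?_
      filter_upwards [h] with ω hω
      refine propext ⟨fun h' => hb ?_, fun h' => h'.elim⟩
      have h' : f ω = b := h'
      rw [← h', hω]
    rw [this]
    simp

theorem logb_card_sub_logb_card_ker {G H : Type*} [AddCommGroup G] [AddCommGroup H] [Finite G]
    (f : G →+ H) (hf : Function.Surjective f) :
    Real.logb 2 (Nat.card G) - Real.logb 2 (Nat.card f.ker) = Real.logb 2 (Nat.card H) := by
  have : Finite H := Finite.of_surjective f hf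
  have hc := AddSubgroup.card_eq_card_quotient_mul_card_addSubgroup f.ker
  rw [Nat.card_congr (QuotientAddGroup.quotientKerEquivOfSurjective f hf).toEquiv] at hc
  rw [hc, Nat.cast_mul, Real.logb_mul (Nat.cast_ne_zero.2 Nat.card_pos.ne')
    (Nat.cast_ne_zero.2 Nat.card_pos.ne'), add_sub_cancel_right]

theorem entropy_equiv {Ω : Type*} [MeasurableSpace Ω] (μ : Measure Ω) {A B : Type*} [Finite A]
    [Finite B] (e : A ≃ B) (X : Ω → A) : entropy μ (fun ω => e (X ω)) = entropy μ X := by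
  rw [entropy, entropy, ← e.tsum_eq]
  refine tsum_congr fun x => ?_
  have : (fun ω => e (X ω)) ⁻¹' {e x} = X ⁻¹' {x} := by
    ext ω
    simp
  rw [this]

/-! ### Irreducibility as a surjectivity statement -/

namespace TreePIN

variable {V : Type u} [Fintype V] {F : Type v} [Field F]

/-- `x ↦ x W`. -/
def wiretapHom (S : TreePIN V F) : S.Base →ₗ[F] (Fin S.nw → F) := S.W.vecMulLinear

/-- `x ↦ Y_e`. -/
def edgeHom (S : TreePIN V F) (e : S.T.edgeSet) : S.Base →ₗ[F] (Fin (S.n e) → F) :=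
  LinearMap.funLeft F F fun k => ⟨e, k⟩

theorem edgeHom_surjective (S : TreePIN V F) (e : S.T.edgeSet) :
    Function.Surjective (S.edgeHom e) :=
  LinearMap.funLeft_surjective_of_injective _ _ _ fun k k' h => by simpa using h

theorem wiretapHom_surjective (S : TreePIN V F) : Function.Surjective S.wiretapHom := by
  have h := S.fullColumnRank
  rw [← Matrix.rank_transpose, Matrix.rank, Matrix.mulVecLin_transpose] at h
  rw [← LinearMap.range_eq_top]
  refine Submodule.eq_top_of_finrank_eq ?_
  rw [Module.finrank_fin_fun]
  exact h

variable [Fintype F]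

/-- The users' source of `S.source` with an arbitrary function `wt` of the base vector as the
wiretapper's observation. It covers both `S.source` and `S.source.withoutWiretapper`. -/
def sourceWith (S : TreePIN V F) {Wt : Type c} [Finite Wt] (wt : S.Base → Wt) :
    Source.{u, max u v, max u v, c} V where
  Ω := S.Base
  finΩ := inferInstance
  law := S.baseLaw
  Z := fun i => (e : {e : S.T.edgeSet // i ∈ (e : Sym2 V)}) → Fin (S.n e) → F
  finZ := fun _ => inferInstance
  obs := fun _ x e => S.Y e x
  W := Wt
  finW := inferInstance
  wiretap := wt

theorem measureReal_singleton (S : TreePIN V F) {Wt : Type c} [Finite Wt] (wt : S.Base → Wt)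
    (x : S.Base) : (S.sourceWith wt).measure.real {x} = (Nat.card S.Base : ℝ)⁻¹ := by
  let : Fintype S.Base := Fintype.ofFinite _
  have h : (S.sourceWith wt).measure {x} = S.baseLaw x :=
    PMF.toMeasure_apply_singleton _ _ trivial
  rw [Measure.real, h, baseLaw]
  rw [PMF.uniformOfFintype_apply, ENNReal.toReal_inv, ENNReal.toReal_natCast,
    Nat.card_eq_fintype_card]

theorem entropy_eq (S : TreePIN V F) {B : Type*} [Finite B] {f : S.source.Ω → B}
    (U : AddSubgroup S.Base) (hf : ∀ x x' : S.Base, f x = f x' ↔ x - x' ∈ U) :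
    entropy S.source.measure f = Real.logb 2 (Nat.card S.Base) - Real.logb 2 (Nat.card U) :=
  entropy_eq_of_uniform (μ := S.source.measure) (G := S.Base) (θ := id) (fun _ => trivial)
    (fun x => S.measureReal_singleton S.wiretapHom x) U hf

theorem edgeEntropy_eq (S : TreePIN V F) (e : S.T.edgeSet) :
    S.edgeEntropy e = S.n e * Real.logb 2 (Fintype.card F) := by
  have h := S.entropy_eq (f := S.Y e) (S.edgeHom e).toAddMonoidHom.ker fun x x' => by
    rw [AddMonoidHom.mem_ker, map_sub, sub_eq_zero]
    rfl
  rw [edgeEntropy, h, logb_card_sub_logb_card_ker _ (S.edgeHom_surjective e)]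
  simp [Nat.card_eq_fintype_card, Real.logb_pow]

/-- In an irreducible source the wiretapper's observation and the observation of any single edge
are independent: a linear relation between them would be a nonconstant common function. -/
theorem Irreducible.surjective {S : TreePIN V F} (hS : S.Irreducible) (e : S.T.edgeSet) :
    Function.Surjective (S.wiretapHom.prod (S.edgeHom e)) := by
  rw [← LinearMap.range_eq_top]
  by_contra hne
  obtain ⟨f, hf0, hf⟩ := Submodule.exists_le_ker_of_lt_top _ (lt_top_iff_ne_top.2 hne)
  have hrel : ∀ x, f (S.wiretapHom x, 0) + f (0, S.edgeHom e x) = 0 := fun x => by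
    rw [← map_add]
    simpa using hf ⟨x, rfl⟩
  -- the linear functional of `Y_e` that is also a linear functional of `Z_w`
  let g : S.Base →ₗ[F] F := f ∘ₗ LinearMap.inr F _ _ ∘ₗ S.edgeHom e
  have hg : ∀ x, g x = f (0, S.edgeHom e x) := fun x => rfl
  obtain ⟨G, _, m, ⟨_, hmax⟩, c, hc⟩ := hS e
  have hm0 : entropy S.source.measure m = 0 := entropy_eq_zero_of_ae_const hc
  let g' : S.source.Ω → Fin (Fintype.card F) := fun x => Fintype.equivFin F (g x)
  have hg' : ∀ x x' : S.Base, g' x = g' x' ↔ g (x - x') = 0 := fun x x' => by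
    rw [map_sub, sub_eq_zero]
    exact (Fintype.equivFin F).injective.eq_iff
  have hker : ∀ (B : Type v) [Finite B] (h : S.source.Ω → B) (U : AddSubgroup S.Base)
      (_ : ∀ x x' : S.Base, h x = h x' ↔ x - x' ∈ U) (_ : ∀ x ∈ U, g x = 0),
      condEntropy S.source.measure g' h = 0 := by
    intro B _ h U hU hUg
    rw [condEntropy, S.entropy_eq (f := h) U hU, S.entropy_eq (f := fun x => (g' x, h x)) U,
      sub_self]
    intro x x'
    rw [Prod.mk.injEq, hU, hg']
    exact ⟨fun h => h.2, fun h => ⟨hUg _ h, h⟩⟩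
  have hcom : entropy S.source.measure g' ≤ 0 := by
    rw [← hm0]
    refine hmax _ g' ⟨hker _ _ (S.edgeHom e).toAddMonoidHom.ker (fun x x' => ?_) fun x hx => ?_,
      hker _ _ S.wiretapHom.toAddMonoidHom.ker (fun x x' => ?_) fun x hx => ?_⟩
    · rw [AddMonoidHom.mem_ker, map_sub, sub_eq_zero]
      rfl
    · have hx : S.edgeHom e x = 0 := hx
      rw [hg, hx]
      exact map_zero f
    · rw [AddMonoidHom.mem_ker, map_sub, sub_eq_zero]
      rfl
    · have hx : S.wiretapHom x = 0 := hx
      have := hrel x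
      have h0 : f (0, 0) = 0 := map_zero f
      rwa [hx, h0, zero_add] at this
  have hg0 : g = 0 := by
    rw [S.entropy_eq (f := g') g.toAddMonoidHom.ker fun x x' => hg' x x',
      sub_nonpos, Real.logb_le_logb (by norm_num) (Nat.cast_pos.2 Nat.card_pos)
      (Nat.cast_pos.2 Nat.card_pos), Nat.cast_le] at hcom
    have htop := AddSubgroup.eq_top_of_le_card _ hcom
    ext1 x
    have : x ∈ g.toAddMonoidHom.ker := htop ▸ AddSubgroup.mem_top x
    exact this
  refine hf0 (LinearMap.ext fun p => ?_)
  obtain ⟨w, y⟩ := p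
  obtain ⟨x, rfl⟩ := S.wiretapHom_surjective w
  obtain ⟨x', rfl⟩ := S.edgeHom_surjective e y
  have h1 := hrel x
  rw [← hg, hg0] at h1
  have h2 := hg x'
  rw [hg0] at h2
  have : ((S.wiretapHom x, S.edgeHom e x') : (Fin S.nw → F) × (Fin (S.n e) → F)) =
    (S.wiretapHom x, 0) + (0, S.edgeHom e x') := by simp
  rw [this, map_add, ← h2]
  simpa using h1

end TreePIN

/-! ### Communication aligned with the wiretapper -/

namespace TreePIN

variable {V : Type u} [Fintype V] {F : Type v} [Field F] [Fintype F]

/-- Over a field extension `Q` of `F` with more elements than the tree has edges, there are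
`s ≤ min n_e` vectors in the left kernel of `W` whose blocks at every edge are linearly
independent. -/
theorem Irreducible.exists_vectors {S : TreePIN V F} (hS : S.Irreducible) {Q : Type*} [Field Q]
    [Finite Q] [Algebra F Q] (hQ : Fintype.card S.T.edgeSet < Nat.card Q) (s : ℕ)
    (hs : ∀ e, s ≤ S.n e) :
    ∃ v : Fin s → ((e : S.T.edgeSet) × Fin (S.n e)) → Q,
      (∀ j, Matrix.vecMul (v j) (S.W.map (algebraMap F Q)) = 0) ∧
      ∀ e, LinearIndependent Q fun j k => v j ⟨e, k⟩ := by
  classical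
  let L := LinearMap.ker (S.W.map (algebraMap F Q)).vecMulLinear
  let π : ∀ e : S.T.edgeSet, L →ₗ[Q] (Fin (S.n e) → Q) := fun e =>
    LinearMap.funLeft Q Q (fun k => (⟨e, k⟩ : (e : S.T.edgeSet) × Fin (S.n e))) ∘ₗ L.subtype
  have hπ : ∀ e, Function.Surjective (π e) := by
    intro e y
    choose ℓ hℓ using fun k => hS.surjective e (0, Pi.single k 1)
    have hℓ1 : ∀ k, Matrix.vecMul (ℓ k) S.W = 0 := fun k => congrArg Prod.fst (hℓ k)
    have hℓ2 : ∀ k k', ℓ k ⟨e, k'⟩ = (Pi.single k 1 : Fin (S.n e) → F) k' := fun k k' =>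
      congrFun (congrArg Prod.snd (hℓ k)) k'
    have hmem : ∀ k, (fun a => algebraMap F Q (ℓ k a)) ∈ L := fun k => by
      rw [LinearMap.mem_ker]
      ext t
      have h0 := congrFun (hℓ1 k) t
      have := RingHom.map_vecMul (algebraMap F Q) S.W (ℓ k) t
      rw [h0] at this
      exact this.symm.trans (map_zero _)
    refine ⟨∑ k, y k • ⟨_, hmem k⟩, ?_⟩
    ext k'
    simp only [π, LinearMap.comp_apply, LinearMap.funLeft_apply, map_sum, Finset.sum_apply,
      map_smul, Pi.smul_apply, Submodule.subtype_apply, smul_eq_mul, hℓ2]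
    rw [Finset.sum_eq_single k']
    · simp
    · intro k _ hk
      simp [hk.symm]
    · simp
  obtain ⟨v, hv⟩ := exists_forall_linearIndependent hQ π hπ s fun e => by
    rw [Module.finrank_fin_fun]
    exact hs e
  exact ⟨fun j => v j, fun j => (v j).2, hv⟩

omit [Fintype F] in
theorem exists_edge [Nontrivial V] (S : TreePIN V F) (i : V) :
    ∃ e : S.T.edgeSet, i ∈ (e : Sym2 V) := by
  obtain ⟨j, hj⟩ := S.isTree.connected.preconnected.exists_adj_of_nontrivial i
  exact ⟨⟨s(i, j), hj⟩, Sym2.mem_mk_left _ _⟩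

omit [Fintype F] in
/-- A vector which is around every vertex a combination of the `v j` is so globally: linear
independence at an edge makes the coefficients of its two ends agree, and the tree is
connected. -/
theorem exists_eq_sum_of_forall_vertex [Nontrivial V] (S : TreePIN V F) {Q : Type*} [Field Q]
    {s : ℕ} {v : Fin s → ((e : S.T.edgeSet) × Fin (S.n e)) → Q}
    (hv : ∀ e, LinearIndependent Q fun j k => v j ⟨e, k⟩)
    {X : ((e : S.T.edgeSet) × Fin (S.n e)) → Q}
    (hX : ∀ i : V, ∃ c : Fin s → Q, ∀ e : S.T.edgeSet, i ∈ (e : Sym2 V) → ∀ k,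
      X ⟨e, k⟩ = ∑ j, c j * v j ⟨e, k⟩) :
    ∃ c : Fin s → Q, ∀ a, X a = ∑ j, c j * v j a := by
  choose c hc using hX
  have hadj : ∀ i i', S.T.Adj i i' → c i = c i' := by
    intro i i' h
    have h1 := hc i ⟨s(i, i'), h⟩ (Sym2.mem_mk_left _ _)
    have h2 := hc i' ⟨s(i, i'), h⟩ (Sym2.mem_mk_right _ _)
    refine funext fun j => sub_eq_zero.1 ?_
    refine Fintype.linearIndependent_iff.1 (hv ⟨s(i, i'), h⟩) (fun j => c i j - c i' j) ?_ j
    ext k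
    simp only [Finset.sum_apply, Pi.smul_apply, smul_eq_mul, sub_mul, Finset.sum_sub_distrib,
      Pi.zero_apply]
    rw [← h1, ← h2, sub_self]
  have hreach : ∀ i i', c i = c i' := by
    intro i i'
    obtain ⟨w⟩ := S.isTree.connected.preconnected i i'
    induction w with
    | nil => rfl
    | cons h _ ih => exact (hadj _ _ h).trans ih
  obtain ⟨i₀⟩ : Nonempty V := inferInstance
  refine ⟨c i₀, fun ⟨e, k⟩ => ?_⟩
  obtain ⟨e, he⟩ := e
  induction e with
  | _ i i' =>
    rw [hreach i₀ i]
    exact hc i _ (Sym2.mem_mk_left _ _) k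

end TreePIN

/-! ### Transcripts of discussions -/

namespace Source

variable {V : Type u} {S : Source.{u, a, b, c} V} {n : ℕ}

namespace Discussion

theorem history_apply (D : S.Discussion n) (ω : D.Sample) {m : ℕ} (t : Fin m) :
    D.history m ω t =
      D.msg t (D.history t ω) (D.obsN (D.speaker t) ω) (ω.2 (D.speaker t)) := by
  induction m with
  | zero => exact t.elim0
  | succ m ih =>
    refine Fin.lastCases ?_ (fun t => ?_) t
    · simp [history]
    · simp only [history, Fin.snoc_castSucc]
      exact ih t

theorem history_castLE (D : S.Discussion n) (ω : D.Sample) {m l : ℕ} (h : m ≤ l) :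
    (fun t : Fin m => D.history l ω (t.castLE h)) = D.history m ω := by
  ext t
  rw [history_apply, history_apply]
  rfl

theorem comm_apply (D : S.Discussion n) (ω : D.Sample) (t : Fin D.len) :
    D.comm ω t = D.msg t (D.history t ω) (D.obsN (D.speaker t) ω) (ω.2 (D.speaker t)) :=
  D.history_apply ω t

/-- A transcript is produced exactly when each of its messages is the one that its speaker sends
after the earlier ones. -/
theorem comm_eq_iff (D : S.Discussion n) (ω : D.Sample) (f : Fin D.len → D.A) :
    D.comm ω = f ↔ ∀ t : Fin D.len,
      D.msg t (fun r => f (r.castLE t.2.le)) (D.obsN (D.speaker t) ω) (ω.2 (D.speaker t)) =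
        f t := by
  constructor
  · rintro rfl t
    rw [comm_apply]
    congr 1
    exact D.history_castLE ω _
  · intro h
    have key : ∀ m (hm : m ≤ D.len), D.history m ω = fun r => f (r.castLE hm) := by
      intro m
      induction m with
      | zero => exact fun _ => funext fun r => r.elim0
      | succ m ih =>
        intro hm
        ext r
        rw [history_apply]
        refine Fin.lastCases ?_ (fun r => ?_) r
        · simp only [Fin.val_last]
          rw [ih (by omega)]
          exact h ⟨m, hm⟩
        · have := congrFun (ih (by omega)) r
          rw [history_apply] at this
          exact this
    exact key _ le_rfl

/-- If every user can tell `g` from the communication and their own observations, then it can be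
output by all users. -/
theorem exists_outputs (D : S.Discussion n) {B : Type*} [Nonempty B] (g : D.Sample → B)
    (h : ∀ i ω ω', D.comm ω = D.comm ω' → D.obsN i ω = D.obsN i ω' → g ω = g ω') :
    ∃ o : D.Outputs B, ∀ i ω, o.E i ω = g ω := by
  classical
  let out : ∀ i, (Fin D.len → D.A) → (Fin n → S.Z i) → B := fun i f z =>
    if h : ∃ ω, D.comm ω = f ∧ D.obsN i ω = z then g h.choose else Classical.arbitrary B
  refine ⟨⟨fun i f z _ => out i f z, fun i f z x => MeasurableSet.const _⟩, fun i ω => ?_⟩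
  have hex : ∃ ω', D.comm ω' = D.comm ω ∧ D.obsN i ω' = D.obsN i ω := ⟨ω, rfl, rfl⟩
  change out i (D.comm ω) (D.obsN i ω) = g ω
  simp only [out, dif_pos hex]
  exact h i _ _ hex.choose_spec.1 hex.choose_spec.2

end Discussion

/-- The discussion without private randomness in which every user `i` announces a function `φ i` of
the user's own observations. -/
def announce [Fintype V] [Nonempty V] (S : Source.{u, a, b, c} V) (n : ℕ) {M : V → Type*}
    [∀ i, Finite (M i)] (φ : ∀ i, (Fin n → S.Z i) → M i) : S.Discussion n where
  R := fun _ => PUnit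
  measR := fun _ => ⊤
  P := fun _ => Measure.dirac PUnit.unit
  probP := fun _ => inferInstance
  A := Fin (Nat.card (Σ i, M i))
  finA := inferInstance
  len := Fintype.card V
  speaker := fun t =>
    if h : t < Fintype.card V then (Fintype.equivFin V).symm ⟨t, h⟩ else Classical.arbitrary V
  msg := fun _ _ z _ => Finite.equivFin (Σ i, M i) ⟨_, φ _ z⟩
  measurable_msg := fun _ _ _ _ => trivial

theorem announce_comm_eq_iff [Fintype V] [Nonempty V] (S : Source.{u, a, b, c} V) (n : ℕ)
    {M : V → Type*} [∀ i, Finite (M i)] (φ : ∀ i, (Fin n → S.Z i) → M i)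
    (ω ω' : (S.announce n φ).Sample) :
    (S.announce n φ).comm ω = (S.announce n φ).comm ω' ↔
      ∀ i, φ i ((S.announce n φ).obsN i ω) = φ i ((S.announce n φ).obsN i ω') := by
  have hc : ∀ ω t, (S.announce n φ).comm ω t = Finite.equivFin (Σ i, M i)
      ⟨_, φ ((S.announce n φ).speaker t) ((S.announce n φ).obsN _ ω)⟩ := fun ω t =>
    (S.announce n φ).comm_apply ω t
  constructor
  · intro h i
    have hsp : (S.announce n φ).speaker (Fintype.equivFin V i) = i := by
      simp [announce]
    have := (Finite.equivFin (Σ i, M i)).injective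
      ((hc ω (Fintype.equivFin V i)).symm.trans ((congrFun h _).trans (hc ω' _)))
    rw [Sigma.mk.injEq, hsp] at this
    exact eq_of_heq this.2
  · intro h
    ext1 t
    rw [hc, hc, h]

end Source

/-! ### The discussion that announces cosets of aligned vectors -/

namespace TreePIN

variable {V : Type u} [Fintype V] {F : Type v} [Field F] [Fintype F]

/-- The `n` realizations of the base vector, in the sample space of a discussion. -/
def base (S : TreePIN V F) {Wt : Type c} [Finite Wt] {wt : S.Base → Wt} {n : ℕ}
    {D : (S.sourceWith wt).Discussion n} (ω : D.Sample) : Fin n → S.Base := ω.1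

/-- A block of `n` realizations of the base vector as one vector over a field `Q` of degree `n`. -/
def blockLift (S : TreePIN V F) {Q : Type*} [Field Q] [Algebra F Q] {n : ℕ}
    (Ψ : (Fin n → F) ≃ₗ[F] Q) :
    (Fin n → S.Base) ≃+ (((e : S.T.edgeSet) × Fin (S.n e)) → Q) where
  toFun x a := Ψ fun t => x t a
  invFun X t a := Ψ.symm (X a) t
  left_inv x := by
    ext t a
    simp
  right_inv X := by
    ext a
    simp
  map_add' x y := by
    ext a
    exact Ψ.map_add (fun t => x t a) fun t => y t a

omit [Fintype F] in
theorem blockLift_apply (S : TreePIN V F) {Q : Type*} [Field Q] [Algebra F Q] {n : ℕ}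
    (Ψ : (Fin n → F) ≃ₗ[F] Q) (x : Fin n → S.Base) (a) :
    S.blockLift Ψ x a = Ψ fun t => x t a := rfl

omit [Fintype F] in
theorem vecMul_blockLift (S : TreePIN V F) {Q : Type*} [Field Q] [Algebra F Q] {n : ℕ}
    (Ψ : (Fin n → F) ≃ₗ[F] Q) (x : Fin n → S.Base) (j : Fin S.nw) :
    Matrix.vecMul (S.blockLift Ψ x) (S.W.map (algebraMap F Q)) j =
      Ψ fun t => S.wiretapHom (x t) j := by
  have : (fun t => S.wiretapHom (x t) j) = ∑ a, S.W a j • fun t => x t a := by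
    ext t
    simp [wiretapHom, Matrix.vecMul, dotProduct, mul_comm]
  rw [this, map_sum]
  simp only [map_smul, Matrix.vecMul, dotProduct, Matrix.map_apply, blockLift_apply]
  exact Finset.sum_congr rfl fun a _ => by rw [Algebra.smul_def, mul_comm]

/-- For all large `n` there is a discussion after which the users are omniscient, whose transcript
is, up to relabelling, the coset of the `n` realizations modulo a group of order `q ^ (n s)`, and
which determines the wiretapper's observation. Every user announces the block of the user's own
observations modulo the span of aligned vectors over the extension of degree `n`. -/
theorem Irreducible.exists_discussion [Nontrivial V] {S : TreePIN V F} (hS : S.Irreducible)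
    {Wt : Type c} [Finite Wt] (wt : S.Base → Wt)
    (hwt : ∀ x x', S.wiretapHom x = S.wiretapHom x' → wt x = wt x') (s : ℕ)
    (hs : ∀ e, s ≤ S.n e) (n : ℕ) (hn0 : n ≠ 0)
    (hn : Fintype.card S.T.edgeSet < Fintype.card F ^ n) :
    ∃ (D : (S.sourceWith wt).Discussion n) (U : AddSubgroup (Fin n → S.Base)),
      Nat.card U = Fintype.card F ^ (n * s) ∧
      (∀ ω ω' : D.Sample, D.comm ω = D.comm ω' ↔
        S.base ω - S.base ω' ∈ U) ∧
      (∀ ω ω' : D.Sample, D.comm ω = D.comm ω' → D.wiretapN ω = D.wiretapN ω') ∧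
      ∀ i (ω ω' : D.Sample), D.comm ω = D.comm ω' → D.obsN i ω = D.obsN i ω' →
        S.base ω = S.base ω' := by
  obtain ⟨p, hp⟩ := CharP.exists F
  have : Fact p.Prime := ⟨CharP.char_is_prime F p⟩
  have : NeZero n := ⟨hn0⟩
  let Q := FiniteField.Extension F p n
  have hcard : Nat.card Q = Fintype.card F ^ n := by
    rw [← Nat.card_eq_fintype_card]
    exact FiniteField.natCard_extension F p n
  let Ψ : (Fin n → F) ≃ₗ[F] Q := LinearEquiv.ofFinrankEq _ _ (by
    rw [Module.finrank_fin_fun]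
    exact (FiniteField.finrank_extension F p n).symm)
  obtain ⟨v, hvW, hv⟩ := hS.exists_vectors (Q := Q) (hcard ▸ hn) s hs
  let L := S.blockLift Ψ
  let U : AddSubgroup (Fin n → S.Base) :=
    (Submodule.span Q (Set.range v)).toAddSubgroup.comap L.toAddMonoidHom
  have hU : ∀ x, x ∈ U ↔ ∃ c : Fin s → Q, ∀ a, L x a = ∑ j, c j * v j a := by
    intro x
    change L x ∈ Submodule.span Q (Set.range v) ↔ _
    rw [Submodule.mem_span_range_iff_exists_fun]
    refine exists_congr fun c => ?_
    rw [eq_comm, funext_iff]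
    simp
  -- the aligned vectors as seen by user `i`
  let loc : ∀ i : V, Fin s → (e : {e : S.T.edgeSet // i ∈ (e : Sym2 V)}) → Fin (S.n e) → Q :=
    fun i j e k => v j ⟨e, k⟩
  let P : ∀ i : V, Submodule Q ((e : {e : S.T.edgeSet // i ∈ (e : Sym2 V)}) → Fin (S.n e) → Q) :=
    fun i => Submodule.span Q (Set.range (loc i))
  have hfin : ∀ i, Finite (_ ⧸ P i) := fun i => Finite.of_surjective _ (P i).mkQ_surjective
  let φ : ∀ i, (Fin n → (S.sourceWith wt).Z i) → _ ⧸ P i := fun i z =>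
    (P i).mkQ fun e k => Ψ fun t => z t e k
  let D := (S.sourceWith wt).announce n φ
  have hcomm : ∀ ω ω' : D.Sample, D.comm ω = D.comm ω' ↔
      S.base ω - S.base ω' ∈ U := by
    intro ω ω'
    rw [Source.announce_comm_eq_iff, hU]
    have hloc : ∀ i, φ i (D.obsN i ω) = φ i (D.obsN i ω') ↔ ∃ c : Fin s → Q,
        ∀ e : S.T.edgeSet, i ∈ (e : Sym2 V) → ∀ k,
          L (S.base ω - S.base ω') ⟨e, k⟩ =
            ∑ j, c j * v j ⟨e, k⟩ := by
      intro i
      change Submodule.Quotient.mk _ = Submodule.Quotient.mk _ ↔ _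
      rw [Submodule.Quotient.eq, Submodule.mem_span_range_iff_exists_fun]
      refine exists_congr fun c => ?_
      rw [eq_comm, funext_iff, map_sub]
      constructor
      · intro h e he k
        have := congrFun (h ⟨e, he⟩) k
        simp only [Finset.sum_apply, Pi.smul_apply, smul_eq_mul] at this
        exact this
      · rintro h ⟨e, he⟩
        ext k
        simp only [Finset.sum_apply, Pi.smul_apply, smul_eq_mul]
        exact h e he k
    constructor
    · intro h
      exact S.exists_eq_sum_of_forall_vertex hv fun i => (hloc i).1 (h i)
    · rintro ⟨c, hc⟩ i
      exact (hloc i).2 ⟨c, fun e _ k => hc _⟩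
  refine ⟨D, U, ?_, hcomm, ?_, ?_⟩
  · obtain ⟨i⟩ : Nonempty V := inferInstance
    obtain ⟨e, _⟩ := S.exists_edge i
    have hli : LinearIndependent Q v :=
      LinearIndependent.of_comp (LinearMap.funLeft Q Q
        (fun k => (⟨e, k⟩ : (e : S.T.edgeSet) × Fin (S.n e)))) (hv e)
    have h1 : Nat.card U = Nat.card (Submodule.span Q (Set.range v)) :=
      Nat.card_congr (L.toEquiv.subtypeEquiv fun x => Iff.rfl)
    rw [h1, Module.natCard_eq_pow_finrank (K := Q), finrank_span_eq_card hli, hcard,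
      Fintype.card_fin, pow_mul]
  · intro ω ω' h
    obtain ⟨c, hc⟩ := (hU _).1 ((hcomm _ _).1 h)
    have hc' : L (S.base ω - S.base ω') =
        ∑ j, c j • v j := by
      ext a
      simpa using hc a
    ext t
    refine hwt _ _ (funext fun j => ?_)
    have h0 := S.vecMul_blockLift Ψ
      (S.base ω - S.base ω') j
    change Matrix.vecMul (L _) _ j = _ at h0
    rw [hc', Matrix.sum_vecMul] at h0
    simp only [Matrix.smul_vecMul, hvW, smul_zero, Finset.sum_const_zero, Pi.zero_apply] at h0
    have h1 := congrFun ((LinearEquiv.map_eq_zero_iff Ψ).1 h0.symm) t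
    have h2 : S.wiretapHom (S.base ω t - S.base ω' t) j = 0 := h1
    rw [map_sub, Pi.sub_apply, sub_eq_zero] at h2
    exact h2
  · intro i ω ω' h hobs
    obtain ⟨c, hc⟩ := (hU _).1 ((hcomm _ _).1 h)
    obtain ⟨e, he⟩ := S.exists_edge i
    have hc0 : c = 0 := by
      refine funext fun j => Fintype.linearIndependent_iff.1 (hv e) c ?_ j
      ext k
      have h0 : L (S.base ω) ⟨e, k⟩ =
          L (S.base ω') ⟨e, k⟩ := by
        refine congrArg Ψ (funext fun t => ?_)
        exact congrFun (congrFun (congrFun hobs t) ⟨e, he⟩) k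
      have := hc ⟨e, k⟩
      rw [map_sub, Pi.sub_apply, h0, sub_self] at this
      simpa using this.symm
    have h0 : L (S.base ω - S.base ω') = 0 := by
      ext a
      rw [hc, hc0]
      simp
    exact sub_eq_zero.1 ((map_eq_zero_iff L L.injective).1 h0)

end TreePIN

/-! ### The sample space of a discussion -/

namespace Source

variable {V : Type u} {S : Source.{u, a, b, c} V} {n : ℕ}

instance : DiscreteMeasurableSpace S.Ω := ⟨fun _ => trivial⟩

namespace Discussion

theorem measurableSet_preimage_fst (D : S.Discussion n) (s : Set (Fin n → S.Ω)) :
    MeasurableSet {ω : D.Sample | ω.1 ∈ s} :=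
  measurable_fst (MeasurableSet.of_discrete (s := s))

variable [Fintype V]

instance (D : S.Discussion n) : IsProbabilityMeasure D.measure := by
  unfold measure
  infer_instance

theorem measureReal_preimage_fst (D : S.Discussion n) (x : Fin n → S.Ω) :
    D.measure.real {ω | ω.1 = x} = ∏ t, S.measure.real {x t} := by
  have h : {ω : D.Sample | ω.1 = x} = {x} ×ˢ Set.univ := by
    ext ω
    simp
  rw [measure, h, measureReal_prod_prod, probReal_univ, mul_one, Measure.real,
    Measure.pi_singleton, ENNReal.toReal_prod]
  rfl

/-- Conditioning on the `n` realizations of the source. -/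
theorem measureReal_eq_sum (D : S.Discussion n) [Fintype (Fin n → S.Ω)] {E : Set D.Sample}
    (hE : MeasurableSet E) :
    D.measure.real E = ∑ x : Fin n → S.Ω,
      (∏ t, S.measure.real {x t}) * (Measure.pi D.P).real {r | (x, r) ∈ E} := by
  rw [measure, Measure.real, Measure.prod_apply hE, lintegral_fintype,
    ENNReal.toReal_sum fun x _ => ENNReal.mul_ne_top (measure_ne_top _ _) (measure_ne_top _ _)]
  refine Finset.sum_congr rfl fun x _ => ?_
  rw [ENNReal.toReal_mul, mul_comm, Measure.pi_singleton, ENNReal.toReal_prod]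
  rfl

end Discussion
end Source

namespace TreePIN

variable {V : Type u} [Fintype V] {F : Type v} [Field F] [Fintype F]

/-- `H(f) = n H(X) - log |U|` for a function `f` of the sample which is, up to relabelling, the
coset modulo `U` of the `n` realizations of the base vector. -/
theorem sample_entropy_eq (S : TreePIN V F) {Wt : Type c} [Finite Wt] {wt : S.Base → Wt} {n : ℕ}
    (D : (S.sourceWith wt).Discussion n) {B : Type*} [Finite B] {f : D.Sample → B}
    (U : AddSubgroup (Fin n → S.Base)) (hf : ∀ ω ω', f ω = f ω' ↔ S.base ω - S.base ω' ∈ U) :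
    entropy D.measure f =
      Real.logb 2 (Nat.card (Fin n → S.Base)) - Real.logb 2 (Nat.card U) := by
  refine entropy_eq_of_uniform (θ := S.base (D := D)) (fun x => ?_) (fun x => ?_) U hf
  · exact D.measurableSet_preimage_fst {x}
  · refine (D.measureReal_preimage_fst x).trans ?_
    refine (Finset.prod_congr rfl fun t _ => S.measureReal_singleton wt (x t)).trans ?_
    rw [Finset.prod_const, Finset.card_univ, Fintype.card_fin, Nat.card_fun (α := Fin n),
      Nat.card_fin, Nat.cast_pow, inv_pow]

/-- The `n` realizations of the wiretapper's observation of `S.source`. -/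
def wiretapHomN (S : TreePIN V F) (n : ℕ) : (Fin n → S.Base) →+ (Fin n → Fin S.nw → F) :=
  S.wiretapHom.toAddMonoidHom.compLeft (Fin n)

theorem logb_card_wiretapHomN_ker (S : TreePIN V F) (n : ℕ) :
    Real.logb 2 (Nat.card (S.wiretapHomN n).ker) =
      n * ((∑ e : S.T.edgeSet, (S.n e : ℝ)) - S.nw) * Real.logb 2 (Fintype.card F) := by
  have h := logb_card_sub_logb_card_ker (S.wiretapHomN n) (S.wiretapHom_surjective.comp_left)
  have h1 : Nat.card (Fin n → S.Base) = Fintype.card F ^ ((∑ e : S.T.edgeSet, S.n e) * n) := by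
    rw [Nat.card_fun, Nat.card_fun, pow_mul]
    simp [Nat.card_eq_fintype_card, Fintype.card_sigma]
  have h2 : Nat.card (Fin n → Fin S.nw → F) = Fintype.card F ^ (S.nw * n) := by
    rw [Nat.card_fun, Nat.card_fun, pow_mul]
    simp [Nat.card_eq_fintype_card]
  rw [h1, h2] at h
  push_cast at h
  rw [Real.logb_pow, Real.logb_pow] at h
  push_cast at h
  linarith

/-! ### Achievability -/

theorem eventually_large (E : ℕ) : ∀ᶠ n : ℕ in atTop, n ≠ 0 ∧ E < Fintype.card F ^ n :=
  (eventually_ne_atTop 0).and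
    ((tendsto_pow_atTop_atTop_of_one_lt Fintype.one_lt_card).eventually_gt_atTop E)

theorem Irreducible.le_CW [Nontrivial V] {S : TreePIN V F} (hS : S.Irreducible)
    {Wt : Type c} [Finite Wt] (wt : S.Base → Wt)
    (hwt : ∀ x x', S.wiretapHom x = S.wiretapHom x' → wt x = wt x') (s : ℕ)
    (hs : ∀ e, s ≤ S.n e) :
    ((s * Real.logb 2 (Fintype.card F) : ℝ) : EReal) ≤ (S.sourceWith wt).CW := by
  have key : ∀ n : ℕ, ∃ (D : (S.sourceWith wt).Discussion n) (κ : ℕ) (o : D.Outputs (Fin κ))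
      (K : D.Sample → Fin κ), (∀ k, MeasurableSet {ω | K ω = k}) ∧
      (n ≠ 0 ∧ Fintype.card S.T.edgeSet < Fintype.card F ^ n → (∀ i ω, o.E i ω = K ω) ∧
        Real.logb 2 κ = n * (s * Real.logb 2 (Fintype.card F)) ∧
        Real.logb 2 κ = condEntropy D.measure K fun ω => (D.comm ω, D.wiretapN ω)) := by
    intro n
    by_cases hn : n ≠ 0 ∧ Fintype.card S.T.edgeSet < Fintype.card F ^ n
    · obtain ⟨D, U, hU, hcomm, hwire, hrec⟩ := hS.exists_discussion wt hwt s hs n hn.1 hn.2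
      -- the key is the position within the coset announced in public
      let k : (Fin n → S.Base) → U := fun x => ⟨-(QuotientAddGroup.mk (s := U) x).out + x,
        QuotientAddGroup.eq.1 (Quotient.out_eq _)⟩
      have hk : ∀ x x', x - x' ∈ U → k x = k x' → x = x' := by
        intro x x' h hxx
        have h1 : QuotientAddGroup.mk (s := U) x = QuotientAddGroup.mk x' := by
          rw [eq_comm, QuotientAddGroup.eq, neg_add_eq_sub]
          exact h
        have h2 := congrArg Subtype.val hxx
        simp only [k, h1] at h2
        exact add_left_cancel h2
      let K : D.Sample → Fin (Nat.card U) := fun ω => Finite.equivFin U (k (S.base ω))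
      have hK : ∀ ω ω', K ω = K ω' ↔ k (S.base ω) = k (S.base ω') := fun ω ω' =>
        (Finite.equivFin U).injective.eq_iff
      have hpos : Nonempty (Fin (Nat.card U)) := ⟨Finite.equivFin U 0⟩
      obtain ⟨o, ho⟩ := D.exists_outputs K fun i ω ω' h h' => by
        rw [hK, hrec i ω ω' h h']
      refine ⟨D, _, o, K, fun κ => ?_, fun _ => ⟨ho, ?_, ?_⟩⟩
      · exact D.measurableSet_preimage_fst {x | Finite.equivFin U (k x) = κ}
      · rw [hU, Nat.cast_pow, Real.logb_pow]
        push_cast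
        ring
      · rw [condEntropy, S.sample_entropy_eq D (f := fun ω => (D.comm ω, D.wiretapN ω)) U,
          S.sample_entropy_eq D (f := fun ω => (K ω, (D.comm ω, D.wiretapN ω))) ⊥]
        · simp
        · intro ω ω'
          rw [Prod.mk.injEq, Prod.mk.injEq, AddSubgroup.mem_bot, sub_eq_zero, hcomm, hK]
          constructor
          · exact fun h => hk _ _ h.2.1 h.1
          · intro h
            have h0 : S.base ω - S.base ω' ∈ U := by
              rw [h, sub_self]
              exact U.zero_mem
            exact ⟨by rw [h], h0, hwire _ _ ((hcomm _ _).2 h0)⟩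
        · intro ω ω'
          rw [Prod.mk.injEq, ← hcomm]
          exact ⟨fun h => h.1, fun h => ⟨h, hwire _ _ h⟩⟩
    -- the finitely many `n` for which the field of degree `n` may be too small do not affect the
    -- limits
    · exact ⟨(S.sourceWith wt).announce n fun _ _ => PUnit.unit.{1}, 1,
        ⟨fun _ _ _ _ => 0, fun _ _ _ _ => MeasurableSet.const _⟩, fun _ => 0,
        fun _ => MeasurableSet.const _, fun h => (hn h).elim⟩
  choose D κ o K hm h using key
  have hev := eventually_large (F := F) (Fintype.card S.T.edgeSet)
  let Q : (S.sourceWith wt).SKAScheme :=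
    { D := D
      𝒦 := fun n => Fin (κ n)
      fin𝒦 := inferInstance
      o := o
      K := K
      measurable_K := hm
      recoverable := by
        refine tendsto_const_nhds.congr' ?_
        filter_upwards [hev] with n hn
        simp [(h n hn).1]
      secret := by
        refine tendsto_const_nhds.congr' ?_
        filter_upwards [hev] with n hn
        rw [Nat.card_fin, ← (h n hn).2.2, sub_self] }
  refine le_trans (le_of_eq ?_) (le_iSup _ Q)
  refine (Tendsto.liminf_eq (tendsto_const_nhds.congr' ?_)).symm
  filter_upwards [hev] with n hn
  have hn0 : (n : ℝ) ≠ 0 := Nat.cast_ne_zero.2 hn.1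
  change _ = ((1 / (n : ℝ) * Real.logb 2 (Nat.card (Fin (κ n))) : ℝ) : EReal)
  rw [Nat.card_fin, (h n hn).2.1]
  congr 1
  field_simp

theorem Irreducible.RL_le [Nontrivial V] {S : TreePIN V F} (hS : S.Irreducible) (s : ℕ)
    (hs : ∀ e, s ≤ S.n e) :
    S.source.RL ≤ ((((∑ e : S.T.edgeSet, (S.n e : ℝ)) - S.nw - s) *
      Real.logb 2 (Fintype.card F) : ℝ) : EReal) := by
  have key : ∀ n : ℕ, ∃ (D : S.source.Discussion n) (o : D.Outputs (∀ i, Fin n → S.source.Z i)),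
      (n ≠ 0 ∧ Fintype.card S.T.edgeSet < Fintype.card F ^ n →
        (∀ i ω, o.E i ω = D.obsAll ω) ∧
        condMutualInfo D.measure D.comm D.obsAll D.wiretapN =
          n * (((∑ e : S.T.edgeSet, (S.n e : ℝ)) - S.nw - s) *
            Real.logb 2 (Fintype.card F))) := by
    intro n
    by_cases hn : n ≠ 0 ∧ Fintype.card S.T.edgeSet < Fintype.card F ^ n
    · obtain ⟨D, U, hU, hcomm, hwire, hrec⟩ :=
        hS.exists_discussion S.wiretapHom (fun _ _ => id) s hs n hn.1 hn.2
      have hbase : ∀ ω ω' : D.Sample, S.base ω = S.base ω' → D.obsAll ω = D.obsAll ω' :=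
        fun ω ω' h => funext fun i => funext fun t =>
          congrArg ((S.sourceWith S.wiretapHom).obs i) (congrFun h t)
      have hobs : ∀ ω ω' : D.Sample, D.obsAll ω = D.obsAll ω' → S.base ω = S.base ω' := by
        intro ω ω' h
        ext t ⟨e, k⟩
        obtain ⟨i, hi⟩ : ∃ i, i ∈ (e : Sym2 V) := ⟨_, Sym2.out_fst_mem _⟩
        exact congrFun (congrFun (congrFun (congrFun h i) t) ⟨e, hi⟩) k
      have hne : Nonempty (∀ i, Fin n → (S.sourceWith S.wiretapHom).Z i) :=
        ⟨fun _ _ _ _ => 0⟩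
      obtain ⟨o, ho⟩ := D.exists_outputs D.obsAll fun i ω ω' h h' =>
        hbase _ _ (hrec i ω ω' h h')
      refine ⟨D, o, fun _ => ⟨ho, ?_⟩⟩
      have hbot : ∀ ω ω' : D.Sample, S.base ω = S.base ω' →
          D.comm ω = D.comm ω' ∧ D.wiretapN ω = D.wiretapN ω' := by
        intro ω ω' h
        have : D.comm ω = D.comm ω' := by
          rw [hcomm, h, sub_self]
          exact U.zero_mem
        exact ⟨this, hwire _ _ this⟩
      have e1 := S.sample_entropy_eq D (f := fun ω => (D.comm ω, D.wiretapN ω)) U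
        fun ω ω' => by
          rw [Prod.mk.injEq, ← hcomm]
          exact ⟨fun h => h.1, fun h => ⟨h, hwire _ _ h⟩⟩
      have e2 := S.sample_entropy_eq D (f := D.wiretapN) (S.wiretapHomN n).ker
        fun ω ω' => by
          rw [AddMonoidHom.mem_ker, map_sub, sub_eq_zero]
          rfl
      have e3 := S.sample_entropy_eq D (f := fun ω => (D.comm ω, (D.obsAll ω, D.wiretapN ω))) ⊥
        fun ω ω' => by
          rw [AddSubgroup.mem_bot, sub_eq_zero, Prod.mk.injEq, Prod.mk.injEq]
          exact ⟨fun h => hobs _ _ h.2.1, fun h =>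
            ⟨(hbot _ _ h).1, hbase _ _ h, (hbot _ _ h).2⟩⟩
      have e4 := S.sample_entropy_eq D (f := fun ω => (D.obsAll ω, D.wiretapN ω)) ⊥
        fun ω ω' => by
          rw [AddSubgroup.mem_bot, sub_eq_zero, Prod.mk.injEq]
          exact ⟨fun h => hobs _ _ h.1, fun h => ⟨hbase _ _ h, (hbot _ _ h).2⟩⟩
      refine (condMutualInfo_eq _ _ _ _).trans ?_
      refine (congrArg₂ _ (congrArg₂ _ e1 e2) (congrArg₂ _ e3 e4)).trans ?_
      rw [S.logb_card_wiretapHomN_ker, hU, Nat.cast_pow, Real.logb_pow]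
      push_cast
      ring
    -- the finitely many `n` for which the field of degree `n` may be too small do not affect the
    -- limits
    · exact ⟨S.source.announce n fun _ _ => PUnit.unit.{1},
        ⟨fun _ _ _ _ _ _ _ _ => 0, fun _ _ _ _ => MeasurableSet.const _⟩,
        fun h => (hn h).elim⟩
  choose D o h using key
  have hev := eventually_large (F := F) (Fintype.card S.T.edgeSet)
  let Q : S.source.OmniscienceScheme :=
    { D := D
      o := o
      recoverable := by
        refine tendsto_const_nhds.congr' ?_
        filter_upwards [hev] with n hn
        simp [(h n hn).1] }
  refine (iInf_le _ Q).trans (le_of_eq ?_)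
  refine Tendsto.limsup_eq (tendsto_const_nhds.congr' ?_)
  filter_upwards [hev] with n hn
  have hn0 : (n : ℝ) ≠ 0 := Nat.cast_ne_zero.2 hn.1
  change _ = ((1 / (n : ℝ) * condMutualInfo (D n).measure (D n).comm (D n).obsAll
    (D n).wiretapN : ℝ) : EReal)
  rw [(h n hn).2]
  congr 1
  field_simp

end TreePIN

/-! ### An upper bound for conditional entropies -/

/-- **Fano's inequality for list decoding.** If `K` is recovered from `(G, Y)` with error
probability at most `δ`, then `G` alone narrows `K` down to a list of `|Y|` values, and
`H(K | G) ≤ 1 + log |Y| + δ log |A|`, where `A` and `Y` are the alphabets.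
This is Gibbs' inequality for the conditional law that is the equal mixture of the uniform laws on
the list and on all values. -/
theorem condEntropy_le_of_list {Ω : Type*} [MeasurableSpace Ω] {μ : Measure Ω}
    [IsProbabilityMeasure μ] {A G Y : Type*} [Finite A] [Finite G] [Finite Y]
    {K : Ω → A} {g : Ω → G} {y : Ω → Y}
    (hK : ∀ k, MeasurableSet (K ⁻¹' {k})) (hg : ∀ x, MeasurableSet (g ⁻¹' {x}))
    (κ : G → Y → A) {δ : ℝ} (hδ : μ.real {ω | K ω ≠ κ (g ω) (y ω)} ≤ δ) :
    condEntropy μ K g ≤ 1 + Real.logb 2 (Nat.card Y) + δ * Real.logb 2 (Nat.card A) := by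
  classical
  have : Fintype A := Fintype.ofFinite A
  have : Fintype G := Fintype.ofFinite G
  have : Fintype Y := Fintype.ofFinite Y
  obtain ⟨ω₀⟩ : Nonempty Ω := nonempty_of_isProbabilityMeasure μ
  have : Nonempty A := ⟨K ω₀⟩
  have : Nonempty Y := ⟨y ω₀⟩
  have hA1 : (1 : ℝ) ≤ Nat.card A := Nat.one_le_cast.2 Nat.card_pos
  have hY1 : (1 : ℝ) ≤ Nat.card Y := Nat.one_le_cast.2 Nat.card_pos
  have hA0 : (0 : ℝ) < Nat.card A := by linarith
  have hY0 : (0 : ℝ) < Nat.card Y := by linarith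
  have hlA := Real.log_nonneg hA1
  have hlY := Real.log_nonneg hY1
  have hl2 : 0 < Real.log 2 := Real.log_pos one_lt_two
  let P : A × G → ℝ := fun z => μ.real ((fun ω => (K ω, g ω)) ⁻¹' {z})
  let Pg : G → ℝ := fun x => μ.real (g ⁻¹' {x})
  have hP0 : ∀ z, 0 ≤ P z := fun z => measureReal_nonneg
  have hpair : ∀ z, MeasurableSet ((fun ω => (K ω, g ω)) ⁻¹' {z}) := fun z => by
    convert (hK z.1).inter (hg z.2) using 1
    ext ω
    simp [Prod.ext_iff]
  have hsum : ∀ s : Finset (A × G), ∑ z ∈ s, P z = μ.real {ω | (K ω, g ω) ∈ s} := fun s =>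
    sum_measureReal_preimage_singleton s fun z _ => hpair z
  have hPg : ∀ x, Pg x = ∑ k, P (k, x) := by
    intro x
    have := hsum (Finset.univ ×ˢ {x})
    rw [Finset.sum_product] at this
    simp only [Finset.sum_singleton] at this
    rw [this]
    refine congrArg μ.real (Set.ext fun ω => ?_)
    simp [eq_comm]
  have hone : ∑ z, P z = 1 := by
    rw [hsum]
    simp
  have hle : ∀ k x, P (k, x) ≤ Pg x := fun k x => by
    rw [hPg]
    exact Finset.single_le_sum (f := fun k => P (k, x)) (fun k _ => hP0 _) (Finset.mem_univ k)
  -- the reference conditional law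
  let L : G → Finset A := fun x => Finset.univ.image (κ x)
  let q : A → G → ℝ := fun k x => ((if k ∈ L x then (Nat.card Y : ℝ)⁻¹ else 0) +
    (Nat.card A : ℝ)⁻¹) / 2
  have hqpos : ∀ k x, 0 < q k x := fun k x => by
    have : 0 < (Nat.card A : ℝ)⁻¹ := inv_pos.2 hA0
    have : 0 ≤ if k ∈ L x then (Nat.card Y : ℝ)⁻¹ else 0 := by positivity
    positivity
  have hqsum : ∀ x, ∑ k, q k x ≤ 1 := by
    intro x
    have hcard : ((L x).card : ℝ) ≤ Nat.card Y := by
      rw [Nat.card_eq_fintype_card]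
      exact Nat.cast_le.2 Finset.card_image_le
    have h1 : ((L x).card : ℝ) * (Nat.card Y : ℝ)⁻¹ ≤ 1 := by
      rw [← div_eq_mul_inv]
      exact (div_le_one hY0).2 hcard
    have h2 : (Fintype.card A : ℝ) * (Nat.card A : ℝ)⁻¹ = 1 := by
      rw [← Nat.card_eq_fintype_card]
      exact mul_inv_cancel₀ hA0.ne'
    simp only [q, ← Finset.sum_div, Finset.sum_add_distrib, Finset.sum_ite_mem,
      Finset.univ_inter, Finset.sum_const, Finset.card_univ, nsmul_eq_mul, h2]
    linarith
  have hq : ∀ k x, -Real.log (q k x) ≤ Real.log 2 + Real.log (Nat.card Y) +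
      (if k ∈ L x then 0 else 1) * Real.log (Nat.card A) := by
    intro k x
    by_cases hk : k ∈ L x
    · have : (2 * Nat.card Y : ℝ)⁻¹ ≤ q k x := by
        simp only [q, hk, if_true, mul_inv]
        have : 0 < (Nat.card A : ℝ)⁻¹ := inv_pos.2 hA0
        linarith
      have := Real.log_le_log (by positivity) this
      rw [Real.log_inv, Real.log_mul two_ne_zero hY0.ne'] at this
      simp only [hk, if_true]
      linarith
    · have : (2 * Nat.card A : ℝ)⁻¹ ≤ q k x := by
        simp only [q, hk, if_false, mul_inv]
        linarith
      have := Real.log_le_log (by positivity) this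
      rw [Real.log_inv, Real.log_mul two_ne_zero hA0.ne'] at this
      simp only [hk, if_false]
      linarith
  have hgibbs : ∀ z : A × G, P z * (Real.log (Pg z.2) - Real.log (P z)) ≤
      (q z.1 z.2 * Pg z.2 - P z) + P z * (Real.log 2 + Real.log (Nat.card Y)) +
        (if z.1 ∈ L z.2 then 0 else P z) * Real.log (Nat.card A) := by
    rintro ⟨k, x⟩
    have h1 : P (k, x) * (Real.log (Pg x) - Real.log (P (k, x)) + Real.log (q k x)) ≤
        q k x * Pg x - P (k, x) := by
      rcases (hP0 (k, x)).eq_or_lt with h0 | h0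
      · rw [← h0, zero_mul, sub_zero]
        exact mul_nonneg (hqpos k x).le measureReal_nonneg
      · have hg0 : 0 < Pg x := h0.trans_le (hle k x)
        have h2 := Real.log_le_sub_one_of_pos
          (div_pos (mul_pos (hqpos k x) hg0) h0)
        rw [Real.log_div (mul_pos (hqpos k x) hg0).ne' h0.ne',
          Real.log_mul (hqpos k x).ne' hg0.ne'] at h2
        have h3 := mul_le_mul_of_nonneg_left h2 h0.le
        rw [mul_sub (P (k, x)) (_ / _), mul_div_cancel₀ _ h0.ne'] at h3
        linarith
    have h2 := mul_le_mul_of_nonneg_left (hq k x) (hP0 (k, x))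
    have h3 : (if k ∈ L x then 0 else P (k, x)) = P (k, x) * (if k ∈ L x then 0 else 1) := by
      split_ifs <;> simp
    simp only [h3]
    linarith
  have hent : condEntropy μ K g =
      (∑ z : A × G, P z * (Real.log (Pg z.2) - Real.log (P z))) / Real.log 2 := by
    rw [condEntropy, entropy, entropy, tsum_fintype, tsum_fintype, ← Finset.sum_div,
      ← Finset.sum_div, ← sub_div]
    congr 1
    have : ∑ x : G, Real.negMulLog (μ.real (g ⁻¹' {x})) =
        -∑ z : A × G, P z * Real.log (Pg z.2) := by
      rw [Fintype.sum_prod_type_right, ← Finset.sum_neg_distrib]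
      refine Finset.sum_congr rfl fun x _ => ?_
      dsimp only
      rw [← Finset.sum_mul, ← hPg, Real.negMulLog, neg_mul]
    rw [this, sub_neg_eq_add, add_comm, ← Finset.sum_add_distrib]
    refine Finset.sum_congr rfl fun z _ => ?_
    rw [Real.negMulLog]
    ring
  have hout : ∑ z : A × G, (if z.1 ∈ L z.2 then 0 else P z) ≤ δ := by
    rw [Finset.sum_congr rfl fun z _ => (ite_not (z.1 ∈ L z.2) (P z) 0).symm, ← Finset.sum_filter,
      hsum]
    refine (measureReal_mono fun ω hω => ?_).trans hδ
    simp only [Finset.mem_filter, Finset.mem_univ, true_and, Set.mem_ofPred_eq] at hω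
    exact fun h => hω (h ▸ Finset.mem_image_of_mem _ (Finset.mem_univ _))
  have hqP : ∑ z : A × G, (q z.1 z.2 * Pg z.2 - P z) ≤ 0 := by
    rw [Finset.sum_sub_distrib, sub_nonpos, Fintype.sum_prod_type_right,
      Fintype.sum_prod_type_right]
    refine Finset.sum_le_sum fun x _ => ?_
    dsimp only
    rw [← Finset.sum_mul, ← hPg]
    exact mul_le_of_le_one_left measureReal_nonneg (hqsum x)
  have htot := Finset.sum_le_sum fun z (_ : z ∈ Finset.univ) => hgibbs z
  rw [Finset.sum_add_distrib, Finset.sum_add_distrib, ← Finset.sum_mul, ← Finset.sum_mul, hone]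
    at htot
  rw [hent, div_le_iff₀ hl2]
  have h1 := mul_le_mul_of_nonneg_right hout hlA
  rw [Real.logb, Real.logb, add_mul, add_mul, mul_div_assoc', div_mul_cancel₀ _ hl2.ne',
    div_mul_cancel₀ _ hl2.ne']
  linarith

/-! ### Two sides of a cut are conditionally independent given the transcript -/

namespace Source

variable {V : Type u} {S : Source.{u, a, b, c} V} {n : ℕ}

namespace Discussion

theorem measurableSet_of_slices (D : S.Discussion n) {E : Set D.Sample}
    (h : ∀ x, MeasurableSet {r | (x, r) ∈ E}) : MeasurableSet E := by
  have hE : E = ⋃ x : Fin n → S.Ω, {ω | ω.1 ∈ ({x} : Set _)} ∩ Prod.snd ⁻¹' {r | (x, r) ∈ E} := by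
    ext ⟨x, r⟩
    simp
  rw [hE]
  exact MeasurableSet.iUnion fun x =>
    (D.measurableSet_preimage_fst {x}).inter (measurable_snd (h x))

theorem measurableSet_comm (D : S.Discussion n) (f : Fin D.len → D.A) :
    MeasurableSet {ω | D.comm ω = f} := by
  refine D.measurableSet_of_slices fun x => ?_
  simp only [Set.mem_ofPred_eq, comm_eq_iff]
  rw [Set.ofPred_forall]
  exact MeasurableSet.iInter fun t =>
    (measurable_pi_apply (D.speaker t) : Measurable fun r : ∀ i, D.R i => r (D.speaker t))
      (D.measurable_msg t (fun m => f (m.castLE t.2.le)) (fun l => S.obs _ (x l)) (f t))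

theorem Outputs.measurableSet_E {D : S.Discussion n} {B : Type*} (o : D.Outputs B) (i : V) (k : B) :
    MeasurableSet {ω | o.E i ω = k} := by
  have hE : {ω | o.E i ω = k} =
      ⋃ f, {ω | D.comm ω = f} ∩ {ω | o.out i f (D.obsN i ω) (ω.2 i) = k} := by
    ext ω
    simp [Outputs.E]
  rw [hE]
  exact MeasurableSet.iUnion fun f => (D.measurableSet_comm f).inter
    (D.measurableSet_of_slices fun x =>
      measurable_pi_apply i (o.measurable_out i f (fun t => S.obs i (x t)) k))

/-- The private randomness of the users satisfying `p` with which, on the realizations `x`, all of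
their messages agree with the transcript `f` and user `i` outputs `k`. -/
def consistent (D : S.Discussion n) {B : Type*} (o : D.Outputs B) (f : Fin D.len → D.A)
    {p : V → Prop} (i : {i // p i}) (k : B) (x : Fin n → S.Ω) : Set (∀ i : {i // p i}, D.R i) :=
  {r | (∀ (t : Fin D.len) (h : p (D.speaker t)),
      D.msg t (fun m => f (m.castLE t.2.le)) (fun l => S.obs (D.speaker t) (x l))
        (r ⟨D.speaker t, h⟩) = f t) ∧
    o.out i f (fun l => S.obs i (x l)) (r i) = k}

theorem measurableSet_consistent (D : S.Discussion n) {B : Type*} (o : D.Outputs B)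
    (f : Fin D.len → D.A) {p : V → Prop} (i : {i // p i}) (k : B) (x : Fin n → S.Ω) :
    MeasurableSet (D.consistent o f i k x) := by
  have h : D.consistent o f i k x =
      (⋂ (t : Fin D.len) (h : p (D.speaker t)), {r | D.msg t (fun m => f (m.castLE t.2.le))
        (fun l => S.obs (D.speaker t) (x l)) (r ⟨D.speaker t, h⟩) = f t}) ∩
      {r | o.out i f (fun l => S.obs i (x l)) (r i) = k} := by
    ext r
    simp [consistent]
  have hm : ∀ i : {i // p i}, Measurable fun r : ∀ i : {i // p i}, D.R i => r i :=
    measurable_pi_apply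
  rw [h]
  exact (MeasurableSet.iInter fun t : Fin D.len => MeasurableSet.iInter fun h =>
      hm ⟨D.speaker t, h⟩ (D.measurable_msg t (fun m => f (m.castLE t.2.le))
        (fun l => S.obs _ (x l)) (f t))).inter
    (hm i (o.measurable_out i f (fun l => S.obs i (x l)) k))

theorem consistent_congr (D : S.Discussion n) {B : Type*} (o : D.Outputs B)
    (f : Fin D.len → D.A) {p : V → Prop} (i : {i // p i}) (k : B) {x x' : Fin n → S.Ω}
    (h : ∀ i, p i → ∀ t, S.obs i (x t) = S.obs i (x' t)) :
    D.consistent o f i k x = D.consistent o f i k x' := by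
  have h' : ∀ i, p i → (fun t => S.obs i (x t)) = fun t => S.obs i (x' t) :=
    fun i hi => funext (h i hi)
  ext r
  refine and_congr (forall₂_congr fun t ht => ?_) ?_
  · rw [h' _ ht]
  · rw [h' _ i.2]

variable [Fintype V]

/-- For given realizations, the event that the transcript is `f` is a rectangle with respect to the
private randomness on the two sides of a partition of the users. -/
theorem measureReal_slice (D : S.Discussion n) {B : Type*} (o : D.Outputs B)
    (f : Fin D.len → D.A) {p : V → Prop} [DecidablePred p] (i : {i // p i}) (j : {i // ¬ p i})
    (k l : B) (x : Fin n → S.Ω) :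
    (Measure.pi D.P).real
        {r | D.comm (x, r) = f ∧ o.E i (x, r) = k ∧ o.E j (x, r) = l} =
      (Measure.pi fun i : {i // p i} => D.P i).real (D.consistent o f i k x) *
        (Measure.pi fun i : {i // ¬ p i} => D.P i).real (D.consistent o f j l x) := by
  have hmp := measurePreserving_piEquivPiSubtypeProd D.P p
  rw [← measureReal_prod_prod, Measure.real, Measure.real, ← hmp.measure_preimage
    ((D.measurableSet_consistent o f i k x).prod
      (D.measurableSet_consistent o f j l x)).nullMeasurableSet]
  congr 2
  ext r
  have hE : ∀ i, D.comm (x, r) = f →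
      o.E i (x, r) = o.out i f (fun l => S.obs i (x l)) (r i) := by
    rintro i rfl
    rfl
  constructor
  · rintro ⟨hf, hk, hl⟩
    rw [hE _ hf] at hk hl
    exact ⟨⟨fun t _ => (D.comm_eq_iff _ f).1 hf t, hk⟩, ⟨fun t _ => (D.comm_eq_iff _ f).1 hf t, hl⟩⟩
  · rintro ⟨⟨h1, hk⟩, ⟨h2, hl⟩⟩
    have hf : D.comm (x, r) = f := by
      rw [comm_eq_iff]
      intro t
      by_cases ht : p (D.speaker t)
      · exact h1 t ht
      · exact h2 t ht
    exact ⟨hf, (hE _ hf).trans hk, (hE _ hf).trans hl⟩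

end Discussion

/-- A cut of a source: the sample space is uniform on a product `𝒜 × ℬ`, the users in `side` observe
functions of the first component, and the other users observe functions of the second
component and of the part `y` of the first component. -/
structure Cut (S : Source.{u, a, b, c} V) (𝒜 ℬ 𝒴 : Type*) where
  side : V → Prop
  split : S.Ω ≃ 𝒜 × ℬ
  y : 𝒜 → 𝒴
  weight : ℝ
  uniform : ∀ ω, S.measure.real {ω} = weight
  obs_side : ∀ i, side i → ∀ ω ω', (split ω).1 = (split ω').1 → S.obs i ω = S.obs i ω'
  obs_compl : ∀ i, ¬ side i → ∀ ω ω', y (split ω).1 = y (split ω').1 →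
    (split ω).2 = (split ω').2 → S.obs i ω = S.obs i ω'

namespace Cut

variable [Fintype V] {𝒜 ℬ 𝒴 : Type*} (C : S.Cut 𝒜 ℬ 𝒴)

/-- The `n` realizations of what is observed on both sides of the cut. -/
def yN {D : S.Discussion n} (ω : D.Sample) : Fin n → 𝒴 := fun t => C.y (C.split (ω.1 t)).1

/-- Given the transcript and the observations common to both sides of a cut, the outputs of users on
different sides are independent. -/
theorem exists_factorization (D : S.Discussion n) {B : Type*} (o : D.Outputs B)
    (i : {i // C.side i}) (j : {i // ¬ C.side i}) (f : Fin D.len → D.A) (η : Fin n → 𝒴) :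
    ∃ α β : B → ℝ, (∀ k, 0 ≤ β k) ∧ ∀ k l, D.measure.real
      {ω | (D.comm ω = f ∧ C.yN ω = η) ∧ o.E i ω = k ∧ o.E j ω = l} = α k * β l := by
  classical
  by_cases hex : ∃ p₀ : Fin n → 𝒜, ∀ t, C.y (p₀ t) = η t
  swap
  · refine ⟨0, 0, fun _ => le_rfl, fun k l => ?_⟩
    have : {ω : D.Sample | (D.comm ω = f ∧ C.yN ω = η) ∧ o.E i ω = k ∧ o.E j ω = l} = ∅ := by
      ext ω
      simp only [Set.mem_ofPred_eq, Set.mem_empty_iff_false, iff_false]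
      rintro ⟨⟨-, h⟩, -⟩
      exact hex ⟨fun t => (C.split (ω.1 t)).1, congrFun h⟩
    rw [this]
    simp
  obtain ⟨p₀, hp₀⟩ := hex
  obtain ⟨ω₀⟩ : Nonempty S.Ω := nonempty_of_isProbabilityMeasure S.measure
  let s₀ : Fin n → ℬ := fun _ => (C.split ω₀).2
  have h𝒜 : Finite 𝒜 := Finite.of_surjective (fun ω => (C.split ω).1)
    (Prod.fst_surjective (β := ℬ) (h := ⟨(C.split ω₀).2⟩) |>.comp C.split.surjective)
  have hℬ : Finite ℬ := Finite.of_surjective (fun ω => (C.split ω).2)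
    (Prod.snd_surjective (α := 𝒜) (h := ⟨(C.split ω₀).1⟩) |>.comp C.split.surjective)
  have : Fintype 𝒜 := Fintype.ofFinite _
  have : Fintype ℬ := Fintype.ofFinite _
  have : Fintype S.Ω := Fintype.ofFinite _
  let e : (Fin n → 𝒜) × (Fin n → ℬ) ≃ (Fin n → S.Ω) :=
    (Equiv.arrowProdEquivProdArrow _ _ _).symm.trans (Equiv.arrowCongr (Equiv.refl _) C.split.symm)
  have he : ∀ p s t, C.split (e (p, s) t) = (p t, s t) := fun p s t =>
    C.split.apply_symm_apply _
  let μA := Measure.pi fun i : {i // C.side i} => D.P i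
  let μB := Measure.pi fun i : {i // ¬ C.side i} => D.P i
  refine ⟨fun k => C.weight ^ n * ∑ p : Fin n → 𝒜,
      if ∀ t, C.y (p t) = η t then μA.real (D.consistent o f i k (e (p, s₀))) else 0,
    fun l => ∑ s : Fin n → ℬ, μB.real (D.consistent o f j l (e (p₀, s))),
    fun l => Finset.sum_nonneg fun _ _ => measureReal_nonneg, fun k l => ?_⟩
  have hmeas : MeasurableSet
      {ω : D.Sample | (D.comm ω = f ∧ C.yN ω = η) ∧ o.E i ω = k ∧ o.E j ω = l} :=
    ((D.measurableSet_comm f).inter (D.measurableSet_preimage_fst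
      {x | (fun t => C.y (C.split (x t)).1) = η})).inter
      ((o.measurableSet_E i k).inter (o.measurableSet_E j l))
  rw [D.measureReal_eq_sum hmeas, ← e.sum_comp, Fintype.sum_prod_type, mul_assoc,
    Finset.sum_mul_sum, Finset.mul_sum]
  refine Finset.sum_congr rfl fun p _ => ?_
  rw [Finset.mul_sum]
  refine Finset.sum_congr rfl fun s _ => ?_
  have hw : ∏ t, S.measure.real {e (p, s) t} = C.weight ^ n := by
    simp [C.uniform]
  rw [hw]
  congr 1
  by_cases hp : ∀ t, C.y (p t) = η t
  · have hset : {r | (e (p, s), r) ∈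
        {ω : D.Sample | (D.comm ω = f ∧ C.yN ω = η) ∧ o.E i ω = k ∧ o.E j ω = l}} =
        {r | D.comm (e (p, s), r) = f ∧ o.E i (e (p, s), r) = k ∧ o.E j (e (p, s), r) = l} := by
      ext r
      have : C.yN (D := D) (e (p, s), r) = η := by
        ext t
        simp only [yN, he, hp]
      simp [this]
    rw [hset, D.measureReal_slice o f i j k l, if_pos hp,
      D.consistent_congr o f i k (x := e (p, s)) (x' := e (p, s₀)),
      D.consistent_congr o f j l (x := e (p, s)) (x' := e (p₀, s))]
    · intro i hi t
      refine C.obs_compl i hi _ _ ?_ ?_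
      · simp only [he, hp, hp₀]
      · simp only [he]
    · intro i hi t
      refine C.obs_side i hi _ _ ?_
      simp only [he]
  · have hset : {r | (e (p, s), r) ∈
        {ω : D.Sample | (D.comm ω = f ∧ C.yN ω = η) ∧ o.E i ω = k ∧ o.E j ω = l}} = ∅ := by
      ext r
      simp only [Set.mem_ofPred_eq, Set.mem_empty_iff_false, iff_false]
      rintro ⟨⟨-, h⟩, -⟩
      refine hp fun t => ?_
      have := congrFun h t
      simpa only [yN, he] using this
    rw [hset, if_neg hp]
    simp

/-- The most likely output given the transcript and the common observations equals the output of
one side with at least the probability that the outputs of the two sides agree. -/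
theorem exists_guess (D : S.Discussion n) {B : Type*} [Finite B] [Nonempty B] [Finite 𝒴]
    (o : D.Outputs B) (i : {i // C.side i}) (j : {i // ¬ C.side i}) :
    ∃ κ : (Fin D.len → D.A) → (Fin n → 𝒴) → B,
      MeasurableSet {ω | o.E i ω = κ (D.comm ω) (C.yN ω)} ∧
      D.measure.real {ω | o.E i ω = o.E j ω} ≤
        D.measure.real {ω | o.E i ω = κ (D.comm ω) (C.yN ω)} := by
  classical
  have : Fintype B := Fintype.ofFinite B
  have : Fintype D.A := Fintype.ofFinite _
  have : Fintype 𝒴 := Fintype.ofFinite _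
  choose α β hβ hαβ using fun (z : (Fin D.len → D.A) × (Fin n → 𝒴)) =>
    C.exists_factorization D o i j z.1 z.2
  choose κ hκ using fun z => Finite.exists_max (α z)
  let Φ : D.Sample → ((Fin D.len → D.A) × (Fin n → 𝒴)) × B × B := fun ω =>
    ((D.comm ω, C.yN ω), (o.E i ω, o.E j ω))
  have hpre : ∀ z k l, Φ ⁻¹' {(z, (k, l))} =
      {ω | (D.comm ω = z.1 ∧ C.yN ω = z.2) ∧ o.E i ω = k ∧ o.E j ω = l} := by
    intro z k l
    ext ω
    simp [Φ, Prod.ext_iff]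
  have hmeas : ∀ z, MeasurableSet (Φ ⁻¹' {z}) := fun ⟨z, k, l⟩ => by
    rw [hpre]
    exact ((D.measurableSet_comm z.1).inter (D.measurableSet_preimage_fst
      {x | (fun t => C.y (C.split (x t)).1) = z.2})).inter
      ((o.measurableSet_E i k).inter (o.measurableSet_E j l))
  have hsum : ∀ q : (((Fin D.len → D.A) × (Fin n → 𝒴)) × B × B) → Prop,
      D.measure.real {ω | q (Φ ω)} = ∑ z, ∑ k, ∑ l, if q (z, (k, l)) then α z k * β z l else 0 := by
    intro q
    have h := sum_measureReal_preimage_singleton (μ := D.measure) (Finset.univ.filter q)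
      fun z _ => hmeas z
    have hset : Φ ⁻¹' ↑(Finset.univ.filter q) = {ω | q (Φ ω)} := by
      ext ω
      simp
    rw [hset] at h
    rw [← h, Finset.sum_filter, Fintype.sum_prod_type]
    refine Finset.sum_congr rfl fun z _ => ?_
    rw [Fintype.sum_prod_type]
    refine Finset.sum_congr rfl fun k _ => Finset.sum_congr rfl fun l _ => ?_
    rw [hpre, hαβ]
  refine ⟨fun f η => κ (f, η), ?_, ?_⟩
  · have : {ω | o.E i ω = κ (D.comm ω, C.yN ω)} =
        ⋃ z ∈ {z : ((Fin D.len → D.A) × (Fin n → 𝒴)) × B × B | z.2.1 = κ z.1}, Φ ⁻¹' {z} := by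
      ext ω
      simp [Φ]
    rw [this]
    exact MeasurableSet.biUnion (Set.to_countable _) fun z _ => hmeas z
  · refine (hsum fun z => z.2.1 = z.2.2).le.trans
      (le_trans ?_ (hsum fun z => z.2.1 = κ z.1).ge)
    refine Finset.sum_le_sum fun z _ => ?_
    have h1 : ∑ k, ∑ l, (if k = l then α z k * β z l else 0) = ∑ l, α z l * β z l := by
      simp
    have h2 : ∑ k, ∑ l, (if k = κ z then α z k * β z l else 0) = ∑ l, α z (κ z) * β z l := by
      rw [Finset.sum_comm]
      simp
    refine h1.le.trans (le_trans ?_ h2.ge)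
    exact Finset.sum_le_sum fun l _ => mul_le_mul_of_nonneg_right (hκ z l) (hβ z l)

/-- What all users can output with small error probability has, given the transcript and the
wiretapper's observation, little more entropy than the observations common to both sides of a
cut. -/
theorem condEntropy_le (D : S.Discussion n) {B : Type*} [Finite B] [Finite 𝒴]
    (o : D.Outputs B) (i : {i // C.side i}) (j : {i // ¬ C.side i}) {K : D.Sample → B}
    (hK : ∀ k, MeasurableSet {ω | K ω = k}) :
    condEntropy D.measure K (fun ω => (D.comm ω, D.wiretapN ω)) ≤
      1 + n * Real.logb 2 (Nat.card 𝒴) +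
        2 * (1 - D.measure.real {ω | ∀ i, o.E i ω = K ω}) * Real.logb 2 (Nat.card B) := by
  obtain ⟨ω₀⟩ : Nonempty D.Sample := nonempty_of_isProbabilityMeasure D.measure
  have : Nonempty B := ⟨K ω₀⟩
  obtain ⟨κ, hκm, hκ⟩ := C.exists_guess D o i j
  have hall : MeasurableSet {ω | ∀ i, o.E i ω = K ω} := by
    have : {ω | ∀ i, o.E i ω = K ω} =
        ⋃ k, {ω | K ω = k} ∩ ⋂ i, {ω | o.E i ω = k} := by
      ext ω
      simp
    rw [this]
    exact MeasurableSet.iUnion fun k => (hK k).inter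
      (MeasurableSet.iInter fun i => o.measurableSet_E i k)
  have hfin : ∀ x, MeasurableSet
      ((fun ω => (D.comm ω, D.wiretapN ω)) ⁻¹' {x}) := fun ⟨f, w⟩ => by
    have : (fun ω => (D.comm ω, D.wiretapN ω)) ⁻¹' {(f, w)} =
        {ω | D.comm ω = f} ∩ {ω | D.wiretapN ω = w} := by
      ext ω
      simp
    rw [this]
    exact (D.measurableSet_comm f).inter
      (D.measurableSet_preimage_fst {x | (fun t => S.wiretap (x t)) = w})
  have h := condEntropy_le_of_list (μ := D.measure) (y := C.yN (D := D)) hK hfin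
    (fun x η => κ x.1 η)
    (δ := 2 * (1 - D.measure.real {ω | ∀ i, o.E i ω = K ω})) (by
      have hsub : {ω | K ω ≠ κ (D.comm ω) (C.yN ω)} ⊆
          {ω | ∀ i, o.E i ω = K ω}ᶜ ∪ {ω | o.E i ω = κ (D.comm ω) (C.yN ω)}ᶜ := by
        intro ω hω
        by_contra hc
        simp only [Set.mem_union, Set.mem_compl_iff, not_or, not_not, Set.mem_ofPred_eq] at hc
        exact hω (by rw [← hc.1 i, hc.2])
      have h1 := (measureReal_mono (μ := D.measure) hsub).trans (measureReal_union_le _ _)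
      rw [probReal_compl_eq_one_sub hall, probReal_compl_eq_one_sub hκm] at h1
      have h2 : D.measure.real {ω | ∀ i, o.E i ω = K ω} ≤
          D.measure.real {ω | o.E i ω = o.E j ω} :=
        measureReal_mono fun ω hω => by
          have hω : ∀ i, o.E i ω = K ω := hω
          exact (hω i).trans (hω j).symm
      linarith)
  rwa [Nat.card_fun, Nat.card_fin, Nat.cast_pow, Real.logb_pow] at h

end Cut
end Source

/-! ### The converse bounds for a tree -/

namespace TreePIN

variable {V : Type u} [Fintype V] {F : Type v} [Field F]

/-- The coordinates of the edge `ij` and of the edges on the side of `i` when `ij` is removed. -/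
def IsNear (S : TreePIN V F) (i j : V) (x : (e : S.T.edgeSet) × Fin (S.n e)) : Prop :=
  (x.1 : Sym2 V) = s(i, j) ∨
    ∃ l ∈ (x.1 : Sym2 V), (S.T.deleteEdges {s(i, j)}).Reachable i l

variable [Fintype F]

open Classical in
/-- The cut of the tree into the components that remain when an edge is removed. -/
def edgeCut (S : TreePIN V F) {Wt : Type c} [Finite Wt] (wt : S.Base → Wt) {i j : V}
    (h : S.T.Adj i j) :
    (S.sourceWith wt).Cut ({x // S.IsNear i j x} → F) ({x // ¬ S.IsNear i j x} → F)
      (Fin (S.n ⟨s(i, j), h⟩) → F) where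
  side := (S.T.deleteEdges {s(i, j)}).Reachable i
  split := Equiv.piEquivPiSubtypeProd (S.IsNear i j) fun _ => F
  y x k := x ⟨⟨⟨s(i, j), h⟩, k⟩, Or.inl rfl⟩
  weight := (Nat.card S.Base : ℝ)⁻¹
  uniform := S.measureReal_singleton wt
  obs_side := fun l hl ω ω' hω => funext fun e => funext fun k =>
    congrFun hω ⟨⟨e, k⟩, Or.inr ⟨l, e.2, hl⟩⟩
  obs_compl := by
    rintro l hl ω ω' hy hω
    refine funext fun ⟨e, hle⟩ => funext fun k => ?_
    by_cases he : e = ⟨s(i, j), h⟩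
    · subst he
      exact congrFun hy k
    · refine congrFun hω ⟨⟨e, k⟩, ?_⟩
      rintro (h' | ⟨m, hm, hreach⟩)
      · exact he (Subtype.ext h')
      · by_cases hlm : m = l
        · exact hl (hlm ▸ hreach)
        · have hem : (e : Sym2 V) = s(m, l) := (Sym2.mem_and_mem_iff hlm).1 ⟨hm, hle⟩
          refine hl (hreach.trans (SimpleGraph.Adj.reachable ?_))
          rw [SimpleGraph.deleteEdges_adj]
          refine ⟨?_, fun h' => he (Subtype.ext (hem.trans h'))⟩
          have := e.2
          rwa [hem] at this

theorem condEntropy_le (S : TreePIN V F) {Wt : Type c} [Finite Wt] (wt : S.Base → Wt)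
    (e : S.T.edgeSet) {n : ℕ} (D : (S.sourceWith wt).Discussion n) {B : Type*} [Finite B]
    (o : D.Outputs B) {K : D.Sample → B} (hK : ∀ k, MeasurableSet {ω | K ω = k}) :
    condEntropy D.measure K (fun ω => (D.comm ω, D.wiretapN ω)) ≤
      1 + n * (S.n e * Real.logb 2 (Fintype.card F)) +
        2 * (1 - D.measure.real {ω | ∀ i, o.E i ω = K ω}) * Real.logb 2 (Nat.card B) := by
  obtain ⟨e, he⟩ := e
  induction e with
  | _ i j =>
    have hj : ¬ (S.T.deleteEdges {s(i, j)}).Reachable i j :=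
      SimpleGraph.isAcyclic_iff_forall_adj_isBridge.1 S.isTree.isAcyclic he
    have := (S.edgeCut wt he).condEntropy_le D o ⟨i, SimpleGraph.Reachable.refl i⟩ ⟨j, hj⟩ hK
    rwa [Nat.card_fun, Nat.card_fin, Nat.cast_pow, Real.logb_pow, Nat.card_eq_fintype_card] at this

theorem CW_le (S : TreePIN V F) {Wt : Type c} [Finite Wt] (wt : S.Base → Wt)
    (e : S.T.edgeSet) :
    (S.sourceWith wt).CW ≤ ((S.n e * Real.logb 2 (Fintype.card F) : ℝ) : EReal) := by
  refine iSup_le fun Q => ?_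
  have := Q.fin𝒦
  set C : ℝ := S.n e * Real.logb 2 (Fintype.card F)
  let ε : ℕ → ℝ := fun n => 2 * (1 - (Q.D n).measure.real {ω | ∀ i, (Q.o n).E i ω = Q.K n ω})
  let d : ℕ → ℝ := fun n => Real.logb 2 (Nat.card (Q.𝒦 n)) -
    condEntropy (Q.D n).measure (Q.K n) (fun ω => ((Q.D n).comm ω, (Q.D n).wiretapN ω))
  have hε : Tendsto ε atTop (𝓝 0) := by
    simpa using (Q.recoverable.const_sub 1).const_mul 2
  have hd : Tendsto d atTop (𝓝 0) := Q.secret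
  have hu : Tendsto (fun n : ℕ => ((d n + 1) * (1 / (n : ℝ)) + C) / (1 - ε n)) atTop (𝓝 C) := by
    have h1 := ((hd.add_const 1).mul tendsto_one_div_atTop_nhds_zero_nat).add_const C
    have h2 := h1.div (hε.const_sub 1) (by norm_num)
    simpa [Pi.div_def] using h2
  refine (liminf_le_liminf ?_).trans
    ((continuous_coe_real_ereal.tendsto C).comp hu).liminf_eq.le
  filter_upwards [hε.eventually_lt_const (zero_lt_one), eventually_ne_atTop 0] with n hn hn0
  have hn0 : (0 : ℝ) < n := Nat.cast_pos.2 (Nat.pos_of_ne_zero hn0)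
  refine EReal.coe_le_coe_iff.2 ?_
  have h := S.condEntropy_le wt e (Q.D n) (Q.o n) (Q.measurable_K n)
  rw [le_div_iff₀ (by linarith)]
  have h1 : Real.logb 2 (Nat.card (Q.𝒦 n)) * (1 - ε n) ≤ d n + 1 + n * C := by
    simp only [d, ε]
    linarith
  calc 1 / (n : ℝ) * Real.logb 2 (Nat.card (Q.𝒦 n)) * (1 - ε n)
      = 1 / (n : ℝ) * (Real.logb 2 (Nat.card (Q.𝒦 n)) * (1 - ε n)) := by ring
    _ ≤ 1 / (n : ℝ) * (d n + 1 + n * C) := mul_le_mul_of_nonneg_left h1 (by positivity)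
    _ = (d n + 1) * (1 / (n : ℝ)) + C := by field_simp

/-- Since `I(F ∧ Z_V | Z_w) = H(Z_V | Z_w) - H(Z_V | F, Z_w)`, omniscience leaks all but what the
observations at one edge leave undetermined. -/
theorem le_RL (S : TreePIN V F) (e : S.T.edgeSet) :
    ((((∑ e : S.T.edgeSet, (S.n e : ℝ)) - S.nw - S.n e) * Real.logb 2 (Fintype.card F) : ℝ) :
      EReal) ≤ S.source.RL := by
  refine le_iInf fun Q => ?_
  set C : ℝ := S.n e * Real.logb 2 (Fintype.card F) with hC
  set H : ℝ := ((∑ e : S.T.edgeSet, (S.n e : ℝ)) - S.nw) * Real.logb 2 (Fintype.card F) with hH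
  let M : ℝ := Real.logb 2 (∏ i, Nat.card (S.source.Z i) : ℕ)
  let ε : ℕ → ℝ := fun n => 2 * (1 - (Q.D n).measure.real
    {ω | ∀ i, (Q.o n).E i ω = (Q.D n).obsAll ω})
  have hε : Tendsto ε atTop (𝓝 0) := by
    simpa using (Q.recoverable.const_sub 1).const_mul 2
  have hu : Tendsto (fun n : ℕ => H - C - 1 / (n : ℝ) - ε n * M) atTop (𝓝 (H - C)) := by
    have h1 := (tendsto_one_div_atTop_nhds_zero_nat.const_sub (H - C)).sub (hε.mul_const M)
    simpa using h1
  rw [sub_mul, ← hC, ← hH]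
  refine ((continuous_coe_real_ereal.tendsto _).comp hu).limsup_eq.ge.trans (limsup_le_limsup ?_)
  filter_upwards [eventually_ne_atTop 0] with n hn0
  have hn0 : (0 : ℝ) < n := Nat.cast_pos.2 (Nat.pos_of_ne_zero hn0)
  refine EReal.coe_le_coe_iff.2 ?_
  let D : (S.sourceWith S.wiretapHom).Discussion n := Q.D n
  have h := S.condEntropy_le S.wiretapHom e D (Q.o n) (K := D.obsAll) fun k =>
    D.measurableSet_preimage_fst {x | (fun i t => (S.sourceWith S.wiretapHom).obs i (x t)) = k}
  have hcard : Real.logb 2 (Nat.card (∀ i, Fin n → S.source.Z i)) = n * M := by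
    have : ∀ i, Nat.card (Fin n → S.source.Z i) = Nat.card (S.source.Z i) ^ n := fun i => by
      rw [Nat.card_fun, Nat.card_fin]
    rw [Nat.card_pi, Finset.prod_congr rfl fun i _ => this i, Finset.prod_pow, Nat.cast_pow,
      Real.logb_pow]
  have e2 := S.sample_entropy_eq D (f := D.wiretapN) (S.wiretapHomN n).ker
    fun ω ω' => by
      rw [AddMonoidHom.mem_ker, map_sub, sub_eq_zero]
      rfl
  have e4 := S.sample_entropy_eq D (f := fun ω => (D.obsAll ω, D.wiretapN ω)) ⊥
    fun ω ω' => by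
      rw [AddSubgroup.mem_bot, sub_eq_zero, Prod.mk.injEq]
      constructor
      · rintro ⟨h, -⟩
        ext t ⟨e, k⟩
        exact congrFun (congrFun (congrFun (congrFun h _) t) ⟨e, Sym2.out_fst_mem _⟩) k
      · intro h
        exact ⟨funext fun i => funext fun t =>
          congrArg ((S.sourceWith S.wiretapHom).obs i) (congrFun h t),
          funext fun t => congrArg S.wiretapHom (congrFun h t)⟩
  have e3 := entropy_equiv D.measure
    ((Equiv.prodAssoc _ _ _).symm.trans (((Equiv.prodComm _ _).prodCongr (Equiv.refl _)).trans
      (Equiv.prodAssoc _ _ _))) fun ω => (D.obsAll ω, (D.comm ω, D.wiretapN ω))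
  have hI : condMutualInfo D.measure D.comm D.obsAll D.wiretapN =
      n * H - condEntropy D.measure D.obsAll (fun ω => (D.comm ω, D.wiretapN ω)) := by
    refine (condMutualInfo_eq _ _ _ _).trans ?_
    have e3' : entropy D.measure (fun ω => (D.comm ω, (D.obsAll ω, D.wiretapN ω))) =
      entropy D.measure fun ω => (D.obsAll ω, (D.comm ω, D.wiretapN ω)) := e3
    rw [e3', e4, e2, condEntropy, S.logb_card_wiretapHomN_ker]
    simp only [AddSubgroup.mem_bot, Nat.card_unique, Nat.cast_one, Real.logb_one, hH]
    ring
  have h1 : n * H - (1 + n * C + ε n * (n * M)) ≤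
      condMutualInfo D.measure D.comm D.obsAll D.wiretapN := by
    rw [hI]
    refine sub_le_sub_left (h.trans (le_of_eq ?_)) _
    rw [← hcard]
    rfl
  calc H - C - 1 / (n : ℝ) - ε n * M = 1 / (n : ℝ) * (n * H - (1 + n * C + ε n * (n * M))) := by
        field_simp
        ring
    _ ≤ _ := mul_le_mul_of_nonneg_left h1 (by positivity)

end TreePIN

end

theorem theorem2 {V : Type u} [Fintype V] [Nontrivial V] {F : Type v} [Field F] [Fintype F]
    (S : TreePIN V F) (hS : S.Irreducible) :
    S.source.CW = ((⨅ e : S.T.edgeSet, S.edgeEntropy e : ℝ) : EReal) ∧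
    S.source.CS = ((⨅ e : S.T.edgeSet, S.edgeEntropy e : ℝ) : EReal) ∧
    S.source.RL =
      ((((∑ e : S.T.edgeSet, (S.n e : ℝ)) - (S.nw : ℝ)) * Real.logb 2 (Fintype.card F) : ℝ) : EReal)
        - S.source.CS := by
  have hne : Nonempty S.T.edgeSet := by
    obtain ⟨i⟩ : Nonempty V := inferInstance
    exact ⟨(S.exists_edge i).choose⟩
  obtain ⟨e₀, he₀⟩ := Finite.exists_min S.n
  have hlog : 0 ≤ Real.logb 2 (Fintype.card F) :=
    Real.logb_nonneg one_lt_two (Nat.one_le_cast.2 Fintype.card_pos)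
  have hmin : ⨅ e : S.T.edgeSet, S.edgeEntropy e = S.n e₀ * Real.logb 2 (Fintype.card F) := by
    refine le_antisymm ((ciInf_le (Set.finite_range _).bddBelow e₀).trans (S.edgeEntropy_eq e₀).le)
      (le_ciInf fun e => ?_)
    rw [S.edgeEntropy_eq]
    exact mul_le_mul_of_nonneg_right (Nat.cast_le.2 (he₀ e)) hlog
  have hCS : S.source.CS = ((⨅ e : S.T.edgeSet, S.edgeEntropy e : ℝ) : EReal) := by
    rw [hmin]
    exact le_antisymm (S.CW_le (fun _ => PUnit.unit) e₀)
      (hS.le_CW (fun _ => PUnit.unit) (fun _ _ _ => rfl) _ he₀)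
  refine ⟨?_, hCS, ?_⟩
  · rw [hmin]
    exact le_antisymm (S.CW_le S.wiretapHom e₀) (hS.le_CW S.wiretapHom (fun _ _ => id) _ he₀)
  · rw [hCS, hmin, ← EReal.coe_sub, ← sub_mul]
    exact le_antisymm (hS.RL_le _ he₀) (S.le_RL e₀)
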